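/- Let $\theta\neq 2$ be a Pisot number, that is, a real algebraic integer $\theta>1$ all of whose other Galois conjugates have modulus less than $1$. Let $\mu_\theta$ be the Bernoulli convolution with parameter $\theta$, the infinite convolution of the measures $\frac12\delta_{-\theta^{-k}}+\frac12\delta_{\theta^{-k}}$, $k=0,1,2,\dots$ (equivalently, the law of the random series $\sum_{k\ge 0}\pm\theta^{-k}$ with independent fair signs), and let $\widehat{\mu_\theta}(t)=\int_{\mathbb R} e^{-2\pi i t x}\,d\mu_\theta(x)$ for $t\in\mathbb R$. For $r>0$ put $\mathcal F_r=\{\widehat{\mu_\theta}(rn): n\in\mathbb Z\}$, and let $\mathcal F_r'$ denote the derived set of $\mathcal F_r$, i.e. the set of its accumulation points. Then: (i) for every positive $r\in\mathbb Q(\theta)$, the set $\mathcal F_r'$ is countably infinite; (ii) the set $J_\theta$ of limit points of $\widehat{\mu_\theta}(t)$ as $t\to+\infty$ along the reals is a non-degenerate compact interval $[a,b]\subset\mathbb R$, $a<b$, and $\mathcal F_r'=J_\theta$ for Lebesgue-almost every $r>0$. -/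

import Mathlib

open MeasureTheory Set Filter Topology
open scoped ENNReal

/-- A Pisot number: a real algebraic integer `θ > 1` all of whose other Galois conjugates
(complex roots of its minimal polynomial over `ℚ`) have modulus less than `1`. -/
def IsPisot (θ : ℝ) : Prop :=
  1 < θ ∧ IsIntegral ℤ θ ∧
    ∀ z : ℂ, Polynomial.aeval z (minpoly ℚ θ) = 0 → z ≠ (θ : ℂ) → ‖z‖ < 1

/-- The symmetric two-point measure `(1/2) δ_{-x} + (1/2) δ_x`. -/
noncomputable def twoPoint (x : ℝ) : Measure ℝ :=
  (2⁻¹ : ℝ≥0∞) • Measure.dirac (-x) + (2⁻¹ : ℝ≥0∞) • Measure.dirac x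

instance twoPoint_isProbabilityMeasure (x : ℝ) : IsProbabilityMeasure (twoPoint x) :=
  ⟨by simp [twoPoint, ENNReal.inv_two_add_inv_two]⟩

/-- The infinite convolution `ν 0 * ν 1 * ν 2 * ⋯` of probability measures on the line: the law of
the sum of a sequence of independent random variables with laws `ν k` (meant for families for which
this random series converges almost surely). -/
noncomputable def infiniteConvolution (ν : ℕ → Measure ℝ) [∀ k, IsProbabilityMeasure (ν k)] :
    Measure ℝ :=
  (Measure.infinitePi ν).map (fun x : ℕ → ℝ => ∑' k, x k)

/-- The Bernoulli convolution `μ_θ`: the infinite convolution of the measures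
`(1/2) δ_{-θ^{-k}} + (1/2) δ_{θ^{-k}}`, `k = 0, 1, 2, …`. -/
noncomputable def bernoulliConvolution (θ : ℝ) : Measure ℝ :=
  infiniteConvolution (fun k : ℕ => twoPoint ((θ ^ k)⁻¹))

/-- The Fourier transform of a measure on the line, `t ↦ ∫ exp (-2πi t x) dμ(x)`. -/
noncomputable def fourierTransform (μ : Measure ℝ) (t : ℝ) : ℂ :=
  ∫ x : ℝ, Complex.exp (-2 * Real.pi * Complex.I * t * x) ∂μ

/-- The set `{μ̂(r n) : n ∈ ℤ}`. -/
def fourierValues (μ : Measure ℝ) (r : ℝ) : Set ℂ :=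
  Set.range (fun n : ℤ => fourierTransform μ (r * n))

/-- The set of limit points of `μ̂(t)` as `t → +∞` along the reals. -/
def fourierLimitPoints (μ : Measure ℝ) : Set ℂ :=
  {z : ℂ | MapClusterPt z atTop (fourierTransform μ)}

/-! ### Infinite products of numbers of modulus at most one -/

/-! By independence the transform is `cosProduct θ t`, the product of `cos (2π t θ⁻ᵏ)` over `k ≥ 0`:
a real, even, Lipschitz function of `t`. Everything is proved for this function and transferred to
`ℂ` at the end.

Infinitude in (i). If the distances from `ξ θᴺ` to `ℤ` are summable, the values at `ξ θᴺ` converge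
to the two-sided product `W(ξ) = biCosProduct θ ξ`. If the same holds for `ξ / r`, integer multiples
of `r` come arbitrarily close to `ξ θᴺ`, so `W(ξ)` lies in the closure of the values at `r ℤ`.
Traces of powers of `θ` supply such `ξ`, and `θ ≠ 2` allows a choice with `w = W(ξ) ≠ 0`. Since `W(ξ
+ η θᴺ) → W(ξ) W(η)`, the closure contains all positive powers of `w`. The powers from `w²` on are
accumulation points, because `W(ξ + ξ θᴺ)` and `W(ξ - ξ θᴺ)` cannot both equal `w²` for large `N`.

Countability in (i). Let `e` be the signed distances of `2 t θ⁻ᵏ` to the nearest integers. The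
modulus of the transform is the product of `|cos (π eₖ)|`, so a lower bound on it bounds `∑ eₖ²`.
The reversed minimal polynomial `Q`, as a polynomial in the shift, kills `θ⁻ᵏ`; hence `Q e` takes
integer values on `k ≥ 0`, with bounded sum of squares. No characteristic root has modulus one, so a
summable Green function recovers `e` from `Q e`. A limit of such sequences splits into blocks
drifting apart, each with finitely supported integer data, and the value becomes a product of block
values. Induction on the sum of squares (`closure_image_boundedBlockSeqs_subset`) puts all two-sided
limits into a countable monoid. For `t = r n` with `r ∈ ℚ(θ)`, one further integrality condition
leaves countably many initial blocks (`countable_halfSeqs`).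

Part (ii). The limit set at infinity contains `0` and some `w ≠ 0`, so the intermediate value
theorem makes it a nondegenerate interval. Accumulation points along `r ℤ` lie in it by evenness.
Conversely, Lebesgue density shows that for almost every `r` the values along `r ℤ` come near every
point of the interval (`volume_setOf_far_eq_zero`), and an interval has no isolated points. -/

theorem Finset.abs_prod_sub_prod_le {ι : Type*} (s : Finset ι) (f g : ι → ℝ)
    (hf : ∀ i, |f i| ≤ 1) (hg : ∀ i, |g i| ≤ 1) :
    |∏ i ∈ s, f i - ∏ i ∈ s, g i| ≤ ∑ i ∈ s, |f i - g i| := by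
  classical
  induction s using Finset.induction_on with
  | empty => simp
  | insert a s ha ih =>
    rw [Finset.prod_insert ha, Finset.prod_insert ha, Finset.sum_insert ha]
    have hP : |∏ i ∈ s, f i| ≤ 1 := by
      rw [Finset.abs_prod]
      exact Finset.prod_le_one (fun i _ => abs_nonneg _) (fun i _ => hf i)
    have h : f a * ∏ i ∈ s, f i - g a * ∏ i ∈ s, g i =
        (f a - g a) * ∏ i ∈ s, f i + g a * (∏ i ∈ s, f i - ∏ i ∈ s, g i) := by ring
    rw [h]
    refine (abs_add_le _ _).trans (add_le_add ?_ ?_)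
    · rw [abs_mul]
      exact mul_le_of_le_one_right (abs_nonneg _) hP
    · rw [abs_mul]
      exact (mul_le_of_le_one_left (abs_nonneg _) (hg a)).trans ih

theorem abs_tprod_sub_tprod_le {ι : Type*} {f g : ι → ℝ} (hfm : Multipliable f)
    (hgm : Multipliable g) (hf : ∀ i, |f i| ≤ 1) (hg : ∀ i, |g i| ≤ 1)
    (h : Summable fun i => |f i - g i|) :
    |∏' i, f i - ∏' i, g i| ≤ ∑' i, |f i - g i| := by
  have h1 : Tendsto (fun s : Finset ι => |∏ i ∈ s, f i - ∏ i ∈ s, g i|) atTop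
      (𝓝 |∏' i, f i - ∏' i, g i|) := (hfm.hasProd.sub hgm.hasProd).abs
  exact le_of_tendsto_of_tendsto' h1 h.hasSum fun s => s.abs_prod_sub_prod_le f g hf hg

/-- One distinguished factor gains `ρ` while the others only decrease. With `ρ < 1` this makes a
termwise comparison of infinite products strict. -/
theorem abs_tprod_le_mul {ι : Type*} {f g : ι → ℝ} (hfm : Multipliable f)
    (hgm : Multipliable g) (hfg : ∀ i, |f i| ≤ |g i|) {ρ : ℝ} (j : ι)
    (hj : |f j| ≤ ρ * |g j|) : |∏' i, f i| ≤ ρ * |∏' i, g i| := by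
  classical
  have h1 : Tendsto (fun s : Finset ι => |∏ i ∈ s, f i|) atTop (𝓝 |∏' i, f i|) :=
    Tendsto.abs hfm.hasProd
  have h2 : Tendsto (fun s : Finset ι => ρ * |∏ i ∈ s, g i|) atTop (𝓝 (ρ * |∏' i, g i|)) :=
    (Tendsto.abs hgm.hasProd).const_mul ρ
  refine le_of_tendsto_of_tendsto h1 h2 ?_
  filter_upwards [eventually_ge_atTop {j}] with s hs
  have hjs : j ∈ s := hs (Finset.mem_singleton_self j)
  rw [← Finset.mul_prod_erase s f hjs, ← Finset.mul_prod_erase s g hjs, abs_mul, abs_mul,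
    ← mul_assoc]
  refine mul_le_mul hj ?_ (abs_nonneg _) ((abs_nonneg _).trans hj)
  rw [Finset.abs_prod, Finset.abs_prod]
  exact Finset.prod_le_prod (fun i _ => abs_nonneg _) (fun i _ => hfg i)

theorem abs_tprod_le_abs {ι : Type*} {f : ι → ℝ} (hfm : Multipliable f)
    (hf : ∀ i, |f i| ≤ 1) (j : ι) : |∏' i, f i| ≤ |f j| := by
  simpa using abs_tprod_le_mul (g := fun _ => (1 : ℝ)) hfm multipliable_one
    (by simpa using hf) (ρ := |f j|) j (by simp)

theorem multipliable_of_summable_abs_sub_one {ι : Type*} {f : ι → ℝ}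
    (h : Summable fun i => |f i - 1|) : Multipliable f := by
  have := multipliable_one_add_of_summable (f := fun i => f i - 1) h
  simpa using this

theorem tprod_ne_zero_of_summable_abs_sub_one {ι : Type*} {f : ι → ℝ}
    (h : Summable fun i => |f i - 1|) (hf : ∀ i, f i ≠ 0) : ∏' i, f i ≠ 0 := by
  have := tprod_one_add_ne_zero_of_summable (f := fun i => f i - 1) (by simpa using hf) h
  simpa using this

theorem summable_abs_cos_sub_one {ι : Type*} {a : ι → ℝ} (h : Summable fun i => |a i|) :
    Summable fun i => |Real.cos (a i) - 1| := by
  refine h.of_nonneg_of_le (fun i => abs_nonneg _) fun i => ?_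
  simpa using Real.abs_cos_sub_cos_le (a i) 0

theorem abs_sin_le_abs (x : ℝ) : |Real.sin x| ≤ |x| := by
  simpa using Real.abs_sin_sub_sin_le x 0

/-- The addition formula makes the factorwise error exactly `sin aᵢ sin bᵢ`, so the product is
almost multiplicative when `a` and `b` are concentrated, modulo `π`, at different indices. All
splitting arguments below rest on this. -/
theorem abs_tprod_cos_add_sub_le {ι : Type*} {a b : ι → ℝ}
    (ha : Summable fun i => |Real.cos (a i) - 1|) (hb : Summable fun i => |Real.cos (b i) - 1|)
    (hab : Summable fun i => |Real.cos (a i + b i) - 1|)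
    (h : Summable fun i => |Real.sin (a i) * Real.sin (b i)|) :
    |∏' i, Real.cos (a i + b i) - (∏' i, Real.cos (a i)) * ∏' i, Real.cos (b i)| ≤
      ∑' i, |Real.sin (a i) * Real.sin (b i)| := by
  have ham := multipliable_of_summable_abs_sub_one ha
  have hbm := multipliable_of_summable_abs_sub_one hb
  rw [← ham.tprod_mul hbm]
  have e : ∀ i, |Real.cos (a i + b i) - Real.cos (a i) * Real.cos (b i)| =
      |Real.sin (a i) * Real.sin (b i)| := by
    intro i
    rw [Real.cos_add, sub_sub_cancel_left, abs_neg]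
  simp_rw [← e] at h ⊢
  refine abs_tprod_sub_tprod_le (multipliable_of_summable_abs_sub_one hab) (ham.mul hbm)
    (fun i => Real.abs_cos_le_one _) (fun i => ?_) h
  rw [abs_mul]
  exact mul_le_one₀ (Real.abs_cos_le_one _) (abs_nonneg _) (Real.abs_cos_le_one _)

/-! ### The Fourier transform as an infinite product of cosines -/

/-- The infinite product `∏ cos (2 π t θ⁻ᵏ)`. -/
noncomputable def cosProduct (θ t : ℝ) : ℝ :=
  ∏' k : ℕ, Real.cos (2 * Real.pi * t * (θ ^ k)⁻¹)

theorem summable_inv_pow {θ : ℝ} (hθ : 1 < θ) : Summable fun k : ℕ => (θ ^ k)⁻¹ := by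
  simp_rw [← inv_pow]
  exact summable_geometric_of_lt_one (by positivity) (inv_lt_one_of_one_lt₀ hθ)

theorem summable_cosProduct_arg {θ : ℝ} (hθ : 1 < θ) (t : ℝ) :
    Summable fun k : ℕ => |2 * Real.pi * t * (θ ^ k)⁻¹| :=
  ((summable_inv_pow hθ).mul_left _).abs

theorem multipliable_cosProduct {θ : ℝ} (hθ : 1 < θ) (t : ℝ) :
    Multipliable fun k : ℕ => Real.cos (2 * Real.pi * t * (θ ^ k)⁻¹) :=
  multipliable_of_summable_abs_sub_one
    (summable_abs_cos_sub_one (summable_cosProduct_arg hθ t))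

theorem cosProduct_neg (θ t : ℝ) : cosProduct θ (-t) = cosProduct θ t := by
  simp [cosProduct]

theorem exists_cosProduct_lipschitz {θ : ℝ} (hθ : 1 < θ) :
    ∃ C : ℝ, 0 < C ∧ ∀ s t, |cosProduct θ s - cosProduct θ t| ≤ C * |s - t| := by
  have hS := summable_inv_pow hθ
  have hpos : ∀ k : ℕ, 0 < (θ ^ k)⁻¹ := fun k => by positivity
  refine ⟨2 * Real.pi * ∑' k : ℕ, (θ ^ k)⁻¹,
    mul_pos (by positivity) (hS.tsum_pos (fun k => (hpos k).le) 0 (hpos 0)), fun s t => ?_⟩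
  have hb : ∀ k : ℕ, |Real.cos (2 * Real.pi * s * (θ ^ k)⁻¹) -
      Real.cos (2 * Real.pi * t * (θ ^ k)⁻¹)| ≤ 2 * Real.pi * |s - t| * (θ ^ k)⁻¹ := by
    intro k
    refine (Real.abs_cos_sub_cos_le _ _).trans_eq ?_
    rw [← sub_mul, ← mul_sub, abs_mul, abs_mul, abs_of_pos (hpos k),
      abs_of_pos (by positivity : 0 < 2 * Real.pi)]
  have hsum := (hS.mul_left (2 * Real.pi * |s - t|)).of_nonneg_of_le (fun k => abs_nonneg _) hb
  refine (abs_tprod_sub_tprod_le (multipliable_cosProduct hθ s) (multipliable_cosProduct hθ t)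
    (fun _ => Real.abs_cos_le_one _) (fun _ => Real.abs_cos_le_one _) hsum).trans ?_
  refine (hsum.tsum_le_tsum hb (hS.mul_left _)).trans_eq ?_
  rw [tsum_mul_left]
  ring

theorem continuous_cosProduct {θ : ℝ} (hθ : 1 < θ) : Continuous (cosProduct θ) := by
  obtain ⟨C, hC, h⟩ := exists_cosProduct_lipschitz hθ
  exact (LipschitzWith.of_dist_le_mul (K := ⟨C, hC.le⟩)
    (fun s t => h s t)).continuous

theorem abs_cosProduct_le_one {θ : ℝ} (hθ : 1 < θ) (t : ℝ) : |cosProduct θ t| ≤ 1 :=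
  (abs_tprod_le_abs (multipliable_cosProduct hθ t) (fun _ => Real.abs_cos_le_one _) 0).trans
    (Real.abs_cos_le_one _)

theorem ae_abs_eq_twoPoint (c : ℝ) : ∀ᵐ y ∂(twoPoint c), |y| = |c| := by
  rw [twoPoint, ae_add_measure_iff]
  constructor
  · refine Measure.ae_smul_measure ?_ _
    rw [ae_dirac_eq]; simp
  · refine Measure.ae_smul_measure ?_ _
    rw [ae_dirac_eq]; simp

theorem integral_exp_twoPoint (c t : ℝ) :
    ∫ y, Complex.exp (-2 * Real.pi * Complex.I * t * y) ∂(twoPoint c) =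
      (Real.cos (2 * Real.pi * t * c) : ℂ) := by
  have hi : ∀ x : ℝ, Integrable (fun y : ℝ => Complex.exp (-2 * Real.pi * Complex.I * t * y))
      ((2⁻¹ : ℝ≥0∞) • Measure.dirac x) := fun x =>
    (integrable_dirac (by simp)).smul_measure (by simp)
  rw [twoPoint, integral_add_measure (hi _) (hi _), integral_smul_measure, integral_smul_measure,
    integral_dirac, integral_dirac, Complex.ofReal_cos, Complex.cos]
  simp only [ENNReal.toReal_inv, ENNReal.toReal_ofNat, Complex.real_smul]
  push_cast
  ring_nf

theorem ae_summable_infinitePi_twoPoint {θ : ℝ} (hθ : 1 < θ) :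
    ∀ᵐ x ∂(Measure.infinitePi fun k : ℕ => twoPoint ((θ ^ k)⁻¹)), Summable x := by
  have h : ∀ᵐ x ∂(Measure.infinitePi fun k : ℕ => twoPoint ((θ ^ k)⁻¹)),
      ∀ k, |x k| = |(θ ^ k)⁻¹| := by
    rw [ae_all_iff]
    intro k
    exact (measurePreserving_eval_infinitePi (fun k : ℕ => twoPoint ((θ ^ k)⁻¹)) k
      ).quasiMeasurePreserving.ae (ae_abs_eq_twoPoint _)
  filter_upwards [h] with x hx
  refine Summable.of_abs ?_
  simp_rw [hx]
  exact (summable_inv_pow hθ).abs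

/-- Independence evaluates the transform of each partial sum as a finite product of cosines;
dominated convergence passes to the almost surely convergent series. -/
theorem fourierTransform_bernoulliConvolution {θ : ℝ} (hθ : 1 < θ) (t : ℝ) :
    fourierTransform (bernoulliConvolution θ) t = cosProduct θ t := by
  set ν : ℕ → Measure ℝ := fun k => twoPoint ((θ ^ k)⁻¹) with hν
  set P := Measure.infinitePi ν with hP
  have hsum : ∀ᵐ x ∂P, Summable x := ae_summable_infinitePi_twoPoint hθ
  have hlim : ∀ᵐ x ∂P, Tendsto (fun n => ∑ k ∈ Finset.range n, x k) atTop (𝓝 (∑' k, x k)) := by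
    filter_upwards [hsum] with x hx using hx.hasSum.tendsto_sum_nat
  have hmeas : AEMeasurable (fun x : ℕ → ℝ => ∑' k, x k) P := by
    refine aemeasurable_of_tendsto_metrizable_ae atTop (fun n => ?_) hlim
    fun_prop
  have hcont : Continuous fun y : ℝ => Complex.exp (-2 * Real.pi * Complex.I * t * y) := by
    fun_prop
  have hnorm : ∀ y : ℝ, ‖Complex.exp (-2 * Real.pi * Complex.I * t * y)‖ = 1 := by
    intro y
    rw [Complex.norm_exp]
    simp
  have h1 : fourierTransform (bernoulliConvolution θ) t =
      ∫ x, Complex.exp (-2 * Real.pi * Complex.I * t * ((∑' k, x k : ℝ) : ℂ)) ∂P := by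
    rw [fourierTransform, bernoulliConvolution, infiniteConvolution,
      integral_map hmeas hcont.aestronglyMeasurable]
  have h2 : Tendsto (fun n : ℕ => ∫ x, Complex.exp (-2 * Real.pi * Complex.I * t *
      ((∑ k ∈ Finset.range n, x k : ℝ) : ℂ)) ∂P) atTop
      (𝓝 (fourierTransform (bernoulliConvolution θ) t)) := by
    rw [h1]
    refine tendsto_integral_of_dominated_convergence (fun _ => 1) (fun n => ?_)
      (integrable_const _) (fun n => ?_) ?_
    · exact hcont.comp_aestronglyMeasurable (by
        refine Measurable.aestronglyMeasurable ?_
        fun_prop)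
    · exact ae_of_all _ fun x => (hnorm _).le
    · filter_upwards [hlim] with x hx
      exact (hcont.tendsto _).comp hx
  have h3 : ∀ n : ℕ, ∫ x, Complex.exp (-2 * Real.pi * Complex.I * t *
      ((∑ k ∈ Finset.range n, x k : ℝ) : ℂ)) ∂P =
      ((∏ k ∈ Finset.range n, Real.cos (2 * Real.pi * t * (θ ^ k)⁻¹) : ℝ) : ℂ) := by
    intro n
    have hind : ProbabilityTheory.iIndepFun
        (fun (i : Fin n) (x : ℕ → ℝ) => Complex.exp (-2 * Real.pi * Complex.I * t * (x i : ℂ))) P :=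
      (ProbabilityTheory.iIndepFun_infinitePi (P := ν)
        (X := fun _ y => Complex.exp (-2 * Real.pi * Complex.I * t * (y : ℂ)))
        (fun _ => hcont.measurable)).precomp Fin.val_injective
    have hh := hind.integral_fun_prod_eq_prod_integral (fun i => by
      refine Measurable.aestronglyMeasurable ?_
      fun_prop)
    have e : ∀ x : ℕ → ℝ, Complex.exp (-2 * Real.pi * Complex.I * t *
      ((∑ k ∈ Finset.range n, x k : ℝ) : ℂ)) =
        ∏ i : Fin n, Complex.exp (-2 * Real.pi * Complex.I * t * (x i : ℂ)) := by
      intro x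
      rw [← Complex.exp_sum, ← Finset.mul_sum, Finset.sum_range]
      push_cast
      rfl
    simp_rw [e]
    rw [hh, Finset.prod_range]
    push_cast
    refine Finset.prod_congr rfl fun i _ => ?_
    have := (measurePreserving_eval_infinitePi ν i).map_eq
    rw [← Complex.ofReal_ofNat, ← Complex.ofReal_mul, ← Complex.ofReal_mul, ← Complex.ofReal_pow,
      ← Complex.ofReal_inv, ← Complex.ofReal_mul, ← Complex.ofReal_cos,
      ← integral_exp_twoPoint ((θ ^ (i : ℕ))⁻¹) t]
    change _ = ∫ y, _ ∂(ν i)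
    rw [← this, integral_map (measurable_pi_apply _).aemeasurable hcont.aestronglyMeasurable]
    rfl
  simp_rw [h3] at h2
  refine tendsto_nhds_unique h2 ?_
  exact (Complex.continuous_ofReal.tendsto _).comp
    (multipliable_cosProduct hθ t).hasProd.tendsto_prod_nat

/-! ### Algebraic preliminaries on Pisot numbers -/

theorem IsPisot.isIntegral_rat {θ : ℝ} (hθ : IsPisot θ) : IsIntegral ℚ θ :=
  hθ.2.1.tower_top

theorem IsPisot.exists_roots {θ : ℝ} (hθ : IsPisot θ) :
    ∃ s : Multiset ℂ, (minpoly ℚ θ).map (algebraMap ℚ ℂ) =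
      (Polynomial.X - Polynomial.C (θ : ℂ)) * (s.map fun α => Polynomial.X - Polynomial.C α).prod ∧
      ∀ α ∈ s, ‖α‖ < 1 := by
  classical
  set P := (minpoly ℚ θ).map (algebraMap ℚ ℂ) with hP
  have hmon : P.Monic := (minpoly.monic hθ.isIntegral_rat).map _
  have hroot : ∀ α : ℂ, α ∈ P.roots ↔ Polynomial.aeval α (minpoly ℚ θ) = 0 := by
    intro α
    rw [Polynomial.mem_roots hmon.ne_zero, Polynomial.IsRoot, hP, Polynomial.eval_map_algebraMap]
  have hnd : P.roots.Nodup := Polynomial.nodup_roots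
    (Polynomial.Separable.map (minpoly.irreducible hθ.isIntegral_rat).separable)
  have hmem : (θ : ℂ) ∈ P.roots := by
    rw [hroot]
    have := Polynomial.aeval_algebraMap_apply ℂ θ (minpoly ℚ θ)
    rw [minpoly.aeval, map_zero] at this
    exact this
  refine ⟨P.roots.erase θ, ?_, fun α hα => ?_⟩
  · rw [← Multiset.prod_cons, ← Multiset.map_cons (fun α : ℂ => Polynomial.X - Polynomial.C α),
      Multiset.cons_erase hmem]
    exact (IsAlgClosed.splits P).eq_prod_roots_of_monic hmon
  · rw [hnd.mem_erase_iff] at hα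
    exact hθ.2.2 α ((hroot α).1 hα.2) hα.1

/-- A relation `θⁿ = q` would pass to a second conjugate `z`, which exists by irrationality, and
force `‖z‖ⁿ = θⁿ`, although `‖z‖ < 1 < θ`. -/
theorem IsPisot.pow_ne_ratCast {θ : ℝ} (hθ : IsPisot θ) (hirr : θ ∉ Set.range ((↑) : ℚ → ℝ))
    {n : ℕ} (hn : n ≠ 0) (q : ℚ) : θ ^ n ≠ q := by
  intro h
  obtain ⟨s, hs, hs1⟩ := hθ.exists_roots
  have hs0 : s ≠ 0 := by
    rintro rfl
    have h1 := congrArg Polynomial.natDegree hs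
    rw [Polynomial.natDegree_map] at h1
    simp only [Multiset.map_zero, Multiset.prod_zero, mul_one, Polynomial.natDegree_X_sub_C] at h1
    rw [minpoly.natDegree_eq_one_iff] at h1
    exact hirr h1
  obtain ⟨z, hz⟩ := Multiset.exists_mem_of_ne_zero hs0
  have hz0 : Polynomial.aeval z (minpoly ℚ θ) = 0 := by
    rw [← Polynomial.eval_map_algebraMap, hs, Polynomial.eval_mul, Polynomial.eval_multiset_prod,
      Multiset.map_map, Multiset.prod_eq_zero, mul_zero]
    exact Multiset.mem_map.2 ⟨z, hz, by simp⟩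
  have hdvd : minpoly ℚ θ ∣ Polynomial.X ^ n - Polynomial.C q := by
    refine minpoly.dvd _ _ ?_
    simp [h]
  obtain ⟨w, hw⟩ := hdvd
  have hzq : z ^ n = (q : ℂ) := by
    have := congrArg (Polynomial.aeval z) hw
    rw [map_mul, hz0, zero_mul] at this
    simpa [sub_eq_zero] using this
  have h1 : ‖z‖ ^ n = θ ^ n := by
    rw [← norm_pow, hzq, h]
    have hq : (0 : ℝ) ≤ q := h ▸ pow_nonneg (by linarith [hθ.1]) n
    have : ((q : ℝ) : ℂ) = (q : ℂ) := by simp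
    rw [← this, Complex.norm_real, Real.norm_of_nonneg hq]
  have h2 : ‖z‖ ^ n < 1 := pow_lt_one₀ (norm_nonneg _) (hs1 z hz) hn
  have h3 : 1 < θ ^ n := one_lt_pow₀ hθ.1 hn
  linarith

/-- The group of real numbers `ξ` for which the distances from `ξ θᴺ` to the integers are
summable. -/
def pisotModule (θ : ℝ) : AddSubgroup ℝ where
  carrier := {ξ | ∃ u : ℕ → ℤ, Summable fun N => |ξ * θ ^ N - u N|}
  zero_mem' := ⟨0, by simp⟩
  add_mem' := by
    rintro ξ η ⟨u, hu⟩ ⟨v, hv⟩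
    refine ⟨u + v, (hu.add hv).of_nonneg_of_le (fun N => abs_nonneg _) fun N => ?_⟩
    refine le_of_eq_of_le ?_ (abs_add_le _ _)
    simp only [Pi.add_apply, Int.cast_add]
    ring_nf
  neg_mem' := by
    rintro ξ ⟨u, hu⟩
    refine ⟨-u, hu.congr fun N => ?_⟩
    rw [← abs_neg]
    simp only [Pi.neg_apply, Int.cast_neg]
    ring_nf

theorem mul_mem_pisotModule {θ ξ : ℝ} (h : ξ ∈ pisotModule θ) : ξ * θ ∈ pisotModule θ := by
  obtain ⟨u, hu⟩ := h
  refine ⟨fun N => u (N + 1), ((summable_nat_add_iff 1).2 hu).congr fun N => ?_⟩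
  ring_nf

theorem mul_pow_mem_pisotModule {θ ξ : ℝ} (h : ξ ∈ pisotModule θ) (n : ℕ) :
    ξ * θ ^ n ∈ pisotModule θ := by
  induction n with
  | zero => simpa using h
  | succ n ih => rw [pow_succ, ← mul_assoc]; exact mul_mem_pisotModule ih

-- The trace of `θᴺ` is an integer, and its distance to `θᴺ` is a sum of `N`th powers of conjugates
-- of modulus less than one, hence geometrically small.
open IntermediateField in
theorem IsPisot.one_mem_pisotModule {θ : ℝ} (hθ : IsPisot θ) : (1 : ℝ) ∈ pisotModule θ := by
  classical
  have hInt := hθ.isIntegral_rat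
  have : FiniteDimensional ℚ ℚ⟮θ⟯ := adjoin.finiteDimensional hInt
  set x : ℚ⟮θ⟯ := AdjoinSimple.gen ℚ θ with hx
  have hxint : IsIntegral ℤ x := by
    have : IsIntegral ℤ (algebraMap ℚ⟮θ⟯ ℝ x) := hθ.2.1
    exact (isIntegral_algebraMap_iff (algebraMap ℚ⟮θ⟯ ℝ).injective).1 this
  have hu : ∀ N : ℕ, ∃ u : ℤ, (u : ℚ) = Algebra.trace ℚ ℚ⟮θ⟯ (x ^ N) := fun N =>
    IsIntegrallyClosed.isIntegral_iff.1 (Algebra.isIntegral_trace (hxint.pow N))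
  choose u hu using hu
  let σ₀ : ℚ⟮θ⟯ →ₐ[ℚ] ℂ := (Complex.ofRealAm.restrictScalars ℚ).comp ℚ⟮θ⟯.val
  have hσ₀ : σ₀ x = θ := rfl
  have hlt : ∀ σ : ℚ⟮θ⟯ →ₐ[ℚ] ℂ, σ ≠ σ₀ → ‖σ x‖ < 1 := by
    intro σ hσ
    refine hθ.2.2 _ ?_ fun h => hσ ?_
    · rw [← minpoly_gen, ← hx, Polynomial.aeval_algHom_apply]
      exact (congrArg σ (minpoly.aeval ℚ x)).trans (map_zero σ)
    · refine (adjoin.powerBasis hInt).algHom_ext ?_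
      rw [adjoin.powerBasis_gen]
      exact h.trans hσ₀.symm
  have hsum : Summable fun N : ℕ => ∑ σ ∈ Finset.univ.erase σ₀, ‖σ x‖ ^ N :=
    summable_sum fun σ hσ => summable_geometric_of_lt_one (norm_nonneg _)
      (hlt σ (Finset.ne_of_mem_erase hσ))
  refine ⟨u, hsum.of_nonneg_of_le (fun N => abs_nonneg _) fun N => ?_⟩
  have h1 := trace_eq_sum_embeddings ℂ (K := ℚ) (L := ℚ⟮θ⟯) (x := x ^ N)
  rw [← hu N, ← Finset.add_sum_erase _ _ (Finset.mem_univ σ₀), map_pow, hσ₀] at h1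
  have h2 : ((1 * θ ^ N - u N : ℝ) : ℂ) = -∑ σ ∈ Finset.univ.erase σ₀, σ (x ^ N) := by
    have : ((u N : ℝ) : ℂ) = algebraMap ℚ ℂ (u N) := by simp
    rw [Complex.ofReal_sub, this, h1]
    push_cast
    ring
  rw [← Real.norm_eq_abs, ← Complex.norm_real, h2, norm_neg]
  refine (norm_sum_le _ _).trans_eq ?_
  simp

theorem IsPisot.aeval_mem_pisotModule {θ : ℝ} (hθ : IsPisot θ) (h : Polynomial ℤ) :
    Polynomial.aeval θ h ∈ pisotModule θ := by
  rw [Polynomial.aeval_eq_sum_range]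
  refine sum_mem fun i _ => zsmul_mem ?_ _
  simpa using mul_pow_mem_pisotModule hθ.one_mem_pisotModule i

theorem Polynomial.exists_natCast_mul_aeval {y : ℝ} (h : Polynomial ℚ) :
    ∃ D : ℕ, 0 < D ∧ ∃ p : Polynomial ℤ, (D : ℝ) * Polynomial.aeval y h = Polynomial.aeval y p := by
  induction h using Polynomial.induction_on' with
  | add f g hf hg =>
    obtain ⟨D, hD, p, hp⟩ := hf
    obtain ⟨E, hE, q, hq⟩ := hg
    refine ⟨D * E, Nat.mul_pos hD hE, (E : Polynomial ℤ) * p + (D : Polynomial ℤ) * q, ?_⟩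
    rw [map_add, map_add, map_mul, map_mul, map_natCast, map_natCast, ← hp, ← hq]
    push_cast
    ring
  | monomial n a =>
    refine ⟨a.den, a.den_pos, Polynomial.monomial n a.num, ?_⟩
    rw [Polynomial.aeval_monomial, Polynomial.aeval_monomial, ← mul_assoc]
    congr 1
    simp only [eq_ratCast, eq_intCast]
    exact_mod_cast Rat.den_mul_eq_num a

open IntermediateField in
theorem exists_natCast_mul_eq_aeval {x y : ℝ} (hy : IsAlgebraic ℚ y) (hx : x ∈ ℚ⟮y⟯) :
    ∃ D : ℕ, 0 < D ∧ ∃ p : Polynomial ℤ, (D : ℝ) * x = Polynomial.aeval y p := by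
  have : x ∈ ℚ⟮y⟯.toSubalgebra := hx
  rw [adjoin_simple_toSubalgebra_of_isAlgebraic hy, Algebra.adjoin_singleton_eq_range_aeval] at this
  obtain ⟨h, rfl⟩ := this
  exact Polynomial.exists_natCast_mul_aeval h

-- The recurrence acts on powers of `θ⁻¹`, so `r⁻¹` will have to be expressed as a polynomial in
-- `θ⁻¹`.
open IntermediateField in
theorem inv_mem_adjoin_inv {x y : ℝ} (hx : x ∈ ℚ⟮y⟯) : x⁻¹ ∈ ℚ⟮y⁻¹⟯ := by
  have h : ℚ⟮y⟯ ≤ ℚ⟮y⁻¹⟯ := by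
    rw [adjoin_simple_le_iff]
    simpa using inv_mem (mem_adjoin_simple_self ℚ y⁻¹)
  exact inv_mem (h hx)

/-! ### Two-sided cosine products -/

/-- The two-sided product `∏ cos (2 π ξ θʲ)` over all integers `j`. -/
noncomputable def biCosProduct (θ ξ : ℝ) : ℝ :=
  ∏' j : ℤ, Real.cos (2 * Real.pi * (ξ * θ ^ j))

/-- For `j ≥ 0` the nearby integers are subtracted; for `j < 0` the angles themselves decay
geometrically. -/
theorem exists_summable_mod_two_pi {θ ξ : ℝ} (hθ : 1 < θ) (hξ : ξ ∈ pisotModule θ) :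
    ∃ a : ℤ → ℝ, (Summable fun j => |a j|) ∧
      ∀ j, ∃ n : ℤ, 2 * Real.pi * (ξ * θ ^ j) = a j + n * (2 * Real.pi) := by
  obtain ⟨u, hu⟩ := hξ
  refine ⟨fun j => if 0 ≤ j then 2 * Real.pi * (ξ * θ ^ j - u j.toNat)
    else 2 * Real.pi * (ξ * θ ^ j), ?_, fun j => ?_⟩
  · refine Summable.of_nat_of_neg_add_one ?_ ?_
    · refine (hu.mul_left (2 * Real.pi)).congr fun N => ?_
      simp [abs_mul, abs_of_pos Real.pi_pos]
    · have h := ((summable_nat_add_iff 1).2 (summable_inv_pow hθ)).mul_left (2 * Real.pi * ξ)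
      refine h.abs.congr fun N => ?_
      beta_reduce
      rw [if_neg (by omega), zpow_neg, ← Nat.cast_add_one, zpow_natCast, mul_assoc]
  · by_cases hj : 0 ≤ j
    · exact ⟨u j.toNat, by simp only [if_pos hj]; ring⟩
    · exact ⟨0, by simp [if_neg hj]⟩

theorem summable_abs_cos_pisot {θ ξ : ℝ} (hθ : 1 < θ) (hξ : ξ ∈ pisotModule θ) :
    Summable fun j : ℤ => |Real.cos (2 * Real.pi * (ξ * θ ^ j)) - 1| := by
  obtain ⟨a, ha, h⟩ := exists_summable_mod_two_pi hθ hξ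
  refine (summable_abs_cos_sub_one ha).congr fun j => ?_
  obtain ⟨n, hn⟩ := h j
  rw [hn, Real.cos_add_int_mul_two_pi]

theorem exists_summable_abs_sin_le {θ ξ : ℝ} (hθ : 1 < θ) (hξ : ξ ∈ pisotModule θ) :
    ∃ a : ℤ → ℝ, (Summable fun j => |a j|) ∧
      ∀ j, |Real.sin (2 * Real.pi * (ξ * θ ^ j))| ≤ |a j| := by
  obtain ⟨a, ha, h⟩ := exists_summable_mod_two_pi hθ hξ
  refine ⟨a, ha, fun j => ?_⟩
  obtain ⟨n, hn⟩ := h j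
  rw [hn, Real.sin_add_int_mul_two_pi]
  exact abs_sin_le_abs _

theorem multipliable_cos_pisot {θ ξ : ℝ} (hθ : 1 < θ) (hξ : ξ ∈ pisotModule θ) :
    Multipliable fun j : ℤ => Real.cos (2 * Real.pi * (ξ * θ ^ j)) :=
  multipliable_of_summable_abs_sub_one (summable_abs_cos_pisot hθ hξ)

theorem biCosProduct_mul_pow {θ : ℝ} (hθ : 1 < θ) (ξ : ℝ) (N : ℕ) :
    biCosProduct θ (ξ * θ ^ N) = biCosProduct θ ξ := by
  unfold biCosProduct
  rw [← (Equiv.addLeft (N : ℤ)).tprod_eq (fun j : ℤ => Real.cos (2 * Real.pi * (ξ * θ ^ j)))]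
  refine tprod_congr fun j => ?_
  rw [Equiv.coe_addLeft, zpow_add₀ (by positivity), zpow_natCast, ← mul_assoc ξ]

theorem summable_abs_sin_mul_sin {θ ξ η : ℝ} (hθ : 1 < θ) (hξ : ξ ∈ pisotModule θ) :
    Summable fun j : ℤ => |Real.sin (2 * Real.pi * (ξ * θ ^ j)) *
      Real.sin (2 * Real.pi * (η * θ ^ j))| := by
  obtain ⟨a, ha, h⟩ := exists_summable_abs_sin_le hθ hξ
  refine ha.of_nonneg_of_le (fun j => abs_nonneg _) fun j => ?_
  rw [abs_mul]
  exact (mul_le_of_le_one_right (abs_nonneg _) (Real.abs_sin_le_one _)).trans (h j)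

theorem tendsto_tsum_abs_sin_mul_sin {θ ξ η : ℝ} (hθ : 1 < θ) (hξ : ξ ∈ pisotModule θ)
    (hη : η ∈ pisotModule θ) :
    Tendsto (fun N : ℕ => ∑' j : ℤ, |Real.sin (2 * Real.pi * (ξ * θ ^ j)) *
      Real.sin (2 * Real.pi * (η * θ ^ N * θ ^ j))|) atTop (𝓝 0) := by
  obtain ⟨a, ha, h⟩ := exists_summable_abs_sin_le hθ hξ
  obtain ⟨b, hb, h'⟩ := exists_summable_abs_sin_le hθ hη
  rw [← tsum_zero (α := ℝ) (β := ℤ)]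
  refine tendsto_tsum_of_dominated_convergence ha (fun j => ?_) (Eventually.of_forall fun N j => ?_)
  · have hb0 : Tendsto (fun N : ℕ => |b (N + j)|) atTop (𝓝 0) := by
      refine hb.tendsto_cofinite_zero.comp ?_
      rw [← Nat.cofinite_eq_atTop]
      refine Function.Injective.tendsto_cofinite fun m n hmn => ?_
      simpa using hmn
    refine squeeze_zero (fun N => abs_nonneg _) (fun N => ?_) hb0
    rw [abs_mul]
    refine (mul_le_of_le_one_left (abs_nonneg _) (Real.abs_sin_le_one _)).trans ?_
    refine le_of_eq_of_le ?_ (h' (N + j))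
    rw [zpow_add₀ (by positivity), zpow_natCast, ← mul_assoc η]
  · rw [Real.norm_eq_abs, abs_abs, abs_mul]
    exact (mul_le_of_le_one_right (abs_nonneg _) (Real.abs_sin_le_one _)).trans (h j)

/-- Multiplying `η` by `θᴺ` translates its summable sequence of sines by `N`, so its overlap with
the sines of `ξ` tends to zero, while `biCosProduct θ η` is unchanged. -/
theorem tendsto_biCosProduct_add_mul_pow {θ ξ η : ℝ} (hθ : 1 < θ) (hξ : ξ ∈ pisotModule θ)
    (hη : η ∈ pisotModule θ) :
    Tendsto (fun N : ℕ => biCosProduct θ (ξ + η * θ ^ N)) atTop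
      (𝓝 (biCosProduct θ ξ * biCosProduct θ η)) := by
  rw [tendsto_iff_dist_tendsto_zero]
  refine squeeze_zero (fun N => dist_nonneg) (fun N => ?_)
    (tendsto_tsum_abs_sin_mul_sin hθ hξ hη)
  have hηN := mul_pow_mem_pisotModule hη N
  have e : ∀ j : ℤ, 2 * Real.pi * ((ξ + η * θ ^ N) * θ ^ j) =
    2 * Real.pi * (ξ * θ ^ j) + 2 * Real.pi * (η * θ ^ N * θ ^ j) := fun j => by ring
  have h := abs_tprod_cos_add_sub_le (summable_abs_cos_pisot hθ hξ)
    (summable_abs_cos_pisot hθ hηN) (by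
      simp_rw [← e]
      exact summable_abs_cos_pisot hθ (add_mem hξ hηN)) (summable_abs_sin_mul_sin hθ hξ)
  simp_rw [← e] at h
  rw [Real.dist_eq, ← biCosProduct_mul_pow hθ η N]
  exact h

/-- The one-sided product at `ξ θᴺ` consists of the two-sided factors with exponent `j ≤ N`; the
missing tail tends to one. -/
theorem tendsto_cosProduct_mul_pow {θ ξ : ℝ} (hθ : 1 < θ) (hξ : ξ ∈ pisotModule θ) :
    Tendsto (fun N : ℕ => cosProduct θ (ξ * θ ^ N)) atTop (𝓝 (biCosProduct θ ξ)) := by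
  set f : ℤ → ℝ := fun j => Real.cos (2 * Real.pi * (ξ * θ ^ j)) with hf
  have hs : Summable fun j => |f j - 1| := summable_abs_cos_pisot hθ hξ
  have hsn : Summable fun n : ℕ => |f n - 1| :=
    hs.comp_injective (i := fun n : ℕ => (n : ℤ)) Nat.cast_injective
  have hfac : ∀ N : ℕ, biCosProduct θ ξ =
      (∏' n : ℕ, f ((n + (N + 1) : ℕ) : ℤ)) * cosProduct θ (ξ * θ ^ N) := by
    intro N
    -- Cutting at `N + 1` makes the nonnegative half the tail `j ≥ N + 1` and the reversed negative
    -- half the one-sided product.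
    have e := (Equiv.addRight ((N : ℤ) + 1)).tprod_eq f
    have h1 : Multipliable fun n : ℕ => f ((n : ℤ) + (N + 1)) := by
      refine multipliable_of_summable_abs_sub_one ?_
      exact hs.comp_injective (i := fun n : ℕ => (n : ℤ) + (N + 1)) fun a b h => by simpa using h
    have h2 : Multipliable fun n : ℕ => f (-((n : ℤ) + 1) + (N + 1)) := by
      refine multipliable_of_summable_abs_sub_one ?_
      exact hs.comp_injective (i := fun n : ℕ => -((n : ℤ) + 1) + (N + 1))
        fun a b h => by simpa using h
    have e2 := tprod_of_nat_of_neg_add_one (f := fun j => f (j + (N + 1))) h1 h2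
    rw [biCosProduct, ← hf, ← e]
    simp only [Equiv.coe_addRight]
    rw [e2]
    congr 1
    refine tprod_congr fun k => ?_
    have : -((k : ℤ) + 1) + (N + 1) = N - k := by ring
    rw [this, hf]
    simp only
    rw [zpow_sub₀ (by positivity), zpow_natCast, zpow_natCast]
    congr 1
    ring
  rw [tendsto_iff_dist_tendsto_zero]
  refine squeeze_zero (fun N => dist_nonneg) (fun N => ?_)
    ((tendsto_sum_nat_add fun n : ℕ => |f n - 1|).comp (tendsto_add_atTop_nat 1))
  have hsN : Summable fun n : ℕ => |f ((n + (N + 1) : ℕ) : ℤ) - 1| :=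
    (summable_nat_add_iff (f := fun n : ℕ => |f n - 1|) (N + 1)).2 hsn
  have h1 := abs_tprod_sub_tprod_le (multipliable_of_summable_abs_sub_one hsN)
    (multipliable_one (β := ℕ)) (fun _ => Real.abs_cos_le_one _) (by simp) hsN
  rw [tprod_one] at h1
  rw [Real.dist_eq, abs_sub_comm, hfac N, ← sub_one_mul, abs_mul]
  exact (mul_le_of_le_one_right (abs_nonneg _) (abs_cosProduct_le_one hθ _)).trans h1

/-- If integers `u N` approximate `(ξ / r) θᴺ`, then `r u N` approximates `ξ θᴺ`, and the Lipschitz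
bound transfers the limit. -/
theorem biCosProduct_mem_closure {θ ξ r : ℝ} (hθ : 1 < θ) (hr : r ≠ 0) (hξ : ξ ∈ pisotModule θ)
    (hξr : ξ / r ∈ pisotModule θ) :
    biCosProduct θ ξ ∈ closure (Set.range fun n : ℤ => cosProduct θ (r * n)) := by
  obtain ⟨u, hu⟩ := hξr
  obtain ⟨C, -, hC⟩ := exists_cosProduct_lipschitz hθ
  refine mem_closure_of_tendsto (f := fun N : ℕ => cosProduct θ (r * u N)) (b := atTop) ?_
    (Eventually.of_forall fun N => ⟨u N, rfl⟩)
  have h0 : Tendsto (fun N : ℕ => C * (|r| * |ξ / r * θ ^ N - u N|)) atTop (𝓝 0) := by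
    simpa using (hu.tendsto_atTop_zero.const_mul |r|).const_mul C
  have h1 : Tendsto (fun N : ℕ => cosProduct θ (ξ * θ ^ N) - cosProduct θ (r * u N)) atTop
      (𝓝 0) := by
    refine squeeze_zero_norm (fun N => (hC _ _).trans_eq ?_) h0
    rw [← abs_mul]
    congr 2
    field_simp
  simpa using (tendsto_cosProduct_mul_pow hθ hξ).sub h1

theorem abs_biCosProduct_lt_one {θ ξ : ℝ} (hθ : 1 < θ) (hξ : ξ ∈ pisotModule θ) (h0 : 0 < ξ) :
    |biCosProduct θ ξ| < 1 := by
  obtain ⟨j, hj⟩ := exists_pow_lt_of_lt_one (show 0 < (2 * ξ)⁻¹ by positivity)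
    (inv_lt_one_of_one_lt₀ hθ)
  refine (abs_tprod_le_abs (multipliable_cos_pisot hθ hξ) (fun _ => Real.abs_cos_le_one _)
    (-(j : ℤ))).trans_lt ?_
  rw [zpow_neg, zpow_natCast, ← inv_pow]
  have hx0 : 0 < ξ * θ⁻¹ ^ j := by positivity
  have hx1 : ξ * θ⁻¹ ^ j < 1 / 2 := by
    calc ξ * θ⁻¹ ^ j < ξ * (2 * ξ)⁻¹ := by gcongr
      _ = 1 / 2 := by field_simp
  set x := ξ * θ⁻¹ ^ j
  have hs : 0 < Real.sin (2 * Real.pi * x) :=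
    Real.sin_pos_of_pos_of_lt_pi (by positivity) (by nlinarith [Real.pi_pos])
  rw [← sq_lt_one_iff_abs_lt_one]
  nlinarith [Real.sin_sq_add_cos_sq (2 * Real.pi * x)]

/-- For large `N`, the two-sided products at `ξ + ξ θᴺ` and `ξ - ξ θᴺ` cannot both be equal to
their common limit. -/
theorem eventually_biCosProduct_ne {θ ξ : ℝ} (hθ : 1 < θ) (hξ : ξ ∈ pisotModule θ) (h0 : 0 < ξ)
    (hne : biCosProduct θ ξ ≠ 0) :
    ∀ᶠ N : ℕ in atTop, biCosProduct θ (ξ + ξ * θ ^ N) ≠ biCosProduct θ ξ ^ 2 ∨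
      biCosProduct θ (ξ + -ξ * θ ^ N) ≠ biCosProduct θ ξ ^ 2 := by
  set w := biCosProduct θ ξ with hw
  set A : ℤ → ℝ := fun j => 2 * Real.pi * (ξ * θ ^ j) with hA
  have hcos : ∀ j, |w| ≤ |Real.cos (A j)| := fun j =>
    abs_tprod_le_abs (multipliable_cos_pisot hθ hξ) (fun _ => Real.abs_cos_le_one _) j
  have hw0 : 0 < |w| := abs_pos.2 hne
  -- Every cosine factor has modulus at least `|w|`. Once the total overlap of sines is below
  -- `|w|²`, each `|sin A sin B|` is at most `|cos A cos B|`.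
  filter_upwards [(tendsto_tsum_abs_sin_mul_sin hθ hξ hξ).eventually_lt_const
    (show 0 < |w| ^ 2 by positivity)] with N hN
  by_contra! hcon
  obtain ⟨h1, h2⟩ := hcon
  have hξN := mul_pow_mem_pisotModule hξ N
  set B : ℤ → ℝ := fun j => 2 * Real.pi * (ξ * θ ^ N * θ ^ j) with hB
  have hBA : ∀ j, B j = A (N + j) := by
    intro j
    simp only [hA, hB]
    rw [zpow_add₀ (by positivity), zpow_natCast, ← mul_assoc ξ]
  have hsin : ∀ j, |Real.sin (A j) * Real.sin (B j)| ≤ |w| ^ 2 := fun j =>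
    ((summable_abs_sin_mul_sin (η := ξ * θ ^ N) hθ hξ).le_tsum j
      fun _ _ => abs_nonneg _).trans hN.le
  have hmA : Multipliable fun j => Real.cos (A j) := multipliable_cos_pisot hθ hξ
  have hmB : Multipliable fun j => Real.cos (B j) := multipliable_cos_pisot hθ hξN
  have hm1 : Multipliable fun j => Real.cos (A j + B j) := by
    refine (multipliable_cos_pisot hθ (add_mem hξ hξN)).congr fun j => ?_
    simp only [hA, hB]; ring_nf
  have hm2 : Multipliable fun j => Real.cos (A j - B j) := by
    refine (multipliable_cos_pisot hθ (sub_mem hξ hξN)).congr fun j => ?_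
    simp only [hA, hB]; ring_nf
  have e1 : biCosProduct θ (ξ + ξ * θ ^ N) = ∏' j, Real.cos (A j + B j) :=
    tprod_congr fun j => by simp only [hA, hB]; ring_nf
  have e2 : biCosProduct θ (ξ + -ξ * θ ^ N) = ∏' j, Real.cos (A j - B j) :=
    tprod_congr fun j => by simp only [hA, hB]; ring_nf
  have eB : w = ∏' j, Real.cos (B j) := (biCosProduct_mul_pow hθ ξ N).symm
  have eA : w = ∏' j, Real.cos (A j) := rfl
  -- Multiplying the two signs turns the error into a subtracted square, so no cancellation between
  -- factors can restore the product `w⁴`.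
  have hpr : ∀ j, Real.cos (A j + B j) * Real.cos (A j - B j) =
      (Real.cos (A j) * Real.cos (B j)) ^ 2 - (Real.sin (A j) * Real.sin (B j)) ^ 2 := by
    intro j
    rw [Real.cos_add, Real.cos_sub]
    ring
  have hge : ∀ j, (Real.sin (A j) * Real.sin (B j)) ^ 2 ≤
      (Real.cos (A j) * Real.cos (B j)) ^ 2 := by
    intro j
    rw [sq_le_sq]
    refine (hsin j).trans ?_
    rw [abs_mul, sq]
    refine mul_le_mul (hcos j) ?_ (abs_nonneg _) (abs_nonneg _)
    rw [hBA]
    exact hcos _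
  have hg0 : ∀ j, 0 < (Real.cos (A j) * Real.cos (B j)) ^ 2 := by
    intro j
    have h3 := hw0.trans_le (hcos j)
    have h4 := hw0.trans_le (hcos (N + j))
    rw [← hBA] at h4
    have := mul_pos h3 h4
    rw [← abs_mul] at this
    exact sq_pos_iff.2 (abs_pos.1 this)
  -- For a sufficiently negative exponent both angles lie in `(0, π)`. This one index makes the
  -- comparison of products strict.
  obtain ⟨j₀, hj₀⟩ : ∃ j, Real.sin (A j) * Real.sin (B j) ≠ 0 := by
    obtain ⟨k, hk⟩ := exists_pow_lt_of_lt_one (show 0 < (2 * (ξ * θ ^ N))⁻¹ by positivity)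
      (inv_lt_one_of_one_lt₀ hθ)
    have hkey : ∀ x : ℝ, 0 < x → x ≤ ξ * θ ^ N →
        Real.sin (2 * Real.pi * (x * θ ^ (-(k : ℤ)))) ≠ 0 := by
      intro x hx hxN
      rw [zpow_neg, zpow_natCast, ← inv_pow]
      have hx0 : 0 < x * θ⁻¹ ^ k := by positivity
      have hx1 : x * θ⁻¹ ^ k < 1 / 2 := by
        calc x * θ⁻¹ ^ k ≤ ξ * θ ^ N * θ⁻¹ ^ k := by gcongr
          _ < ξ * θ ^ N * (2 * (ξ * θ ^ N))⁻¹ := by gcongr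
          _ = 1 / 2 := by field_simp
      exact (Real.sin_pos_of_pos_of_lt_pi (by positivity) (by nlinarith [Real.pi_pos])).ne'
    refine ⟨-(k : ℤ), mul_ne_zero (hkey ξ h0 ?_) (hkey _ (by positivity) le_rfl)⟩
    exact le_mul_of_one_le_right h0.le (one_le_pow₀ hθ.le)
  set g : ℤ → ℝ := fun j => (Real.cos (A j) * Real.cos (B j)) ^ 2 with hg
  set f : ℤ → ℝ := fun j => Real.cos (A j + B j) * Real.cos (A j - B j) with hf
  have hf0 : ∀ j, |f j| = g j - (Real.sin (A j) * Real.sin (B j)) ^ 2 := by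
    intro j
    rw [hf, hg]
    simp only
    rw [hpr, abs_of_nonneg (sub_nonneg.2 (hge j))]
  have hgm : Multipliable g := by
    simp only [hg, sq]
    exact (hmA.mul hmB).mul (hmA.mul hmB)
  have hgt : ∏' j, g j = w ^ 4 := by
    simp only [hg, sq]
    rw [(hmA.mul hmB).tprod_mul (hmA.mul hmB), hmA.tprod_mul hmB, ← eA, ← eB]
    ring
  have hft : ∏' j, f j = w ^ 4 := by
    rw [hm1.tprod_mul hm2, ← e1, ← e2, h1, h2]
    ring
  have hle := abs_tprod_le_mul (hm1.mul hm2) hgm (ρ := |f j₀| / |g j₀|) (fun j => by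
    change |f j| ≤ |g j|
    rw [hf0, abs_of_pos (hg0 j)]
    linarith [sq_nonneg (Real.sin (A j) * Real.sin (B j))]) j₀ (by
    rw [div_mul_cancel₀]
    exact (abs_pos.2 (hg0 j₀).ne').ne')
  change |∏' j, f j| ≤ _ at hle
  rw [hft, hgt] at hle
  have hρ : |f j₀| / |g j₀| < 1 := by
    rw [div_lt_one (abs_pos.2 (hg0 j₀).ne'), hf0, abs_of_pos (hg0 j₀)]
    have : 0 < (Real.sin (A j₀) * Real.sin (B j₀)) ^ 2 := by positivity
    linarith
  have hw4 : 0 < |w ^ 4| := by positivity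
  nlinarith

/-! ### Nonvanishing two-sided products -/

/-- Infinite descent on the odd factor: passing from `e` to `e + 1` gives `2 o mⁿ = o' mⁿ'`. Parity
forces `n' > n`, whence `2 o ≥ 3 o'` and `o' < o`. For `m = 2` and `D > 0` the factorization always
exists, which is how `θ = 2` is exceptional. -/
theorem not_forall_two_pow_mul_eq_odd_mul_pow {D m : ℕ} (hm : 3 ≤ m) :
    ¬ ∀ e : ℕ, ∃ o n : ℕ, Odd o ∧ D * 2 ^ e = o * m ^ n := by
  intro h
  have key : ∀ o e n : ℕ, Odd o → D * 2 ^ e = o * m ^ n → False := by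
    intro o
    induction o using Nat.strong_induction_on with
    | _ o ih =>
      intro e n ho he
      obtain ⟨o', n', ho', he'⟩ := h (e + 1)
      have h2 : 2 * o * m ^ n = o' * m ^ n' := by
        rw [← he', pow_succ, mul_assoc, ← he]; ring
      rcases le_or_gt n' n with hn | hn
      · obtain ⟨k, rfl⟩ := Nat.exists_eq_add_of_le hn
        have h3 : 2 * o * m ^ k = o' := by
          refine Nat.eq_of_mul_eq_mul_right (show 0 < m ^ n' by positivity) ?_
          rw [← h2, pow_add]; ring
        rw [← h3, mul_assoc] at ho'
        exact (Nat.not_odd_iff_even.2 (even_two_mul _)) ho'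
      · obtain ⟨k, rfl⟩ := Nat.exists_eq_add_of_lt hn
        have h3 : 2 * o = o' * m ^ (k + 1) := by
          refine Nat.eq_of_mul_eq_mul_right (show 0 < m ^ n by positivity) ?_
          rw [h2, add_assoc, pow_add]; ring
        refine ih o' ?_ (e + 1) _ ho' he'
        have h4 : 1 ≤ m ^ k := Nat.one_le_pow _ _ (by omega)
        have h5 : o' * 3 ≤ o' * m ^ (k + 1) := by
          refine Nat.mul_le_mul_left _ ?_
          rw [pow_succ]
          nlinarith
        have := ho'.pos
        omega
  obtain ⟨o, n, ho, he⟩ := h 0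
  exact key o 0 n ho he

/-- An equality here is exactly the vanishing of a factor `cos (2π c θʲ)` with `c = D 2ᵉ`. A
rational `θ` is an integer at least three, and the descent applies; for irrational `θ` already `e =
0` works, since no nonzero power of `θ` is rational. -/
theorem IsPisot.exists_mul_zpow_ne_odd {θ : ℝ} (hθ : IsPisot θ) (hθ2 : θ ≠ 2) {D : ℕ}
    (hD : 0 < D) :
    ∃ e : ℕ, ∀ j k : ℤ, 4 * ((D * 2 ^ e : ℕ) : ℝ) * θ ^ j ≠ 2 * k + 1 := by
  have hpos : 0 < θ := by linarith [hθ.1]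
  by_cases hrat : θ ∈ Set.range ((↑) : ℚ → ℝ)
  · obtain ⟨q, hq⟩ := hrat
    have hqint : IsIntegral ℤ q := by
      have : IsIntegral ℤ (algebraMap ℚ ℝ q) := by simpa [hq] using hθ.2.1
      exact (isIntegral_algebraMap_iff (algebraMap ℚ ℝ).injective).1 this
    obtain ⟨z, hz⟩ := IsIntegrallyClosed.isIntegral_iff.1 hqint
    have hzθ : (z : ℝ) = θ := by rw [← hq, ← hz]; simp
    have hz1 : 1 < z := by exact_mod_cast hzθ ▸ hθ.1
    obtain ⟨m, rfl⟩ := Int.eq_ofNat_of_zero_le (by omega : 0 ≤ z)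
    have hm2 : m ≠ 2 := by
      rintro rfl
      exact hθ2 (by rw [← hzθ]; norm_num)
    have hmθ : (m : ℝ) = θ := by exact_mod_cast hzθ
    by_contra! hcon
    refine not_forall_two_pow_mul_eq_odd_mul_pow (D := 4 * D) (m := m) (by omega) fun e => ?_
    obtain ⟨j, k, hjk⟩ := hcon e
    have hk : 0 < 2 * k + 1 := by
      have : (0 : ℝ) < 2 * k + 1 := by rw [← hjk]; positivity
      exact_mod_cast this
    rcases le_or_gt 0 j with hj | hj
    · obtain ⟨n, rfl⟩ := Int.eq_ofNat_of_zero_le hj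
      rw [zpow_natCast, ← hmθ] at hjk
      have : 4 * ((D * 2 ^ e : ℕ) : ℤ) * (m : ℤ) ^ n = 2 * k + 1 := by exact_mod_cast hjk
      have h4 : 2 * (2 * ((D * 2 ^ e : ℕ) : ℤ) * (m : ℤ) ^ n) = 2 * k + 1 := by
        rw [← this]; ring
      omega
    · obtain ⟨n, rfl⟩ : ∃ n : ℕ, j = -n := ⟨j.natAbs, by omega⟩
      obtain ⟨o, ho⟩ := Int.eq_ofNat_of_zero_le hk.le
      refine ⟨o, n, ?_, ?_⟩
      · rw [← Int.odd_coe_nat, ← ho]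
        exact odd_two_mul_add_one k
      · have ho' : (2 * (k : ℝ) + 1) = o := by exact_mod_cast ho
        rw [zpow_neg, zpow_natCast, ho', ← hmθ] at hjk
        have hmn : (m : ℝ) ^ n ≠ 0 := by rw [hmθ]; positivity
        have : (4 * D * 2 ^ e : ℝ) = o * m ^ n := by
          rw [← hjk]
          field_simp
          push_cast
          ring
        exact_mod_cast this
  · refine ⟨0, fun j k hjk => ?_⟩
    rw [pow_zero, mul_one] at hjk
    have hD' : (D : ℝ) ≠ 0 := by positivity
    rcases lt_trichotomy j 0 with hj | rfl | hj
    · obtain ⟨n, rfl⟩ : ∃ n : ℕ, j = -n := ⟨j.natAbs, by omega⟩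
      refine hθ.pow_ne_ratCast hrat (n := n) (by omega) (4 * D / (2 * k + 1)) ?_
      push_cast
      rw [← hjk, zpow_neg, zpow_natCast]
      field_simp
    · rw [zpow_zero, mul_one] at hjk
      have : (4 * D : ℤ) = 2 * k + 1 := by exact_mod_cast hjk
      omega
    · obtain ⟨n, rfl⟩ : ∃ n : ℕ, j = n := ⟨j.natAbs, by omega⟩
      refine hθ.pow_ne_ratCast hrat (n := n) (by omega) ((2 * k + 1) / (4 * D)) ?_
      push_cast
      rw [← hjk, zpow_natCast]
      field_simp

theorem IsPisot.exists_biCosProduct_ne_zero {θ : ℝ} (hθ : IsPisot θ) (hθ2 : θ ≠ 2) {D : ℕ}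
    (hD : 0 < D) :
    ∃ c : ℕ, 0 < c ∧ D ∣ c ∧ biCosProduct θ c ≠ 0 := by
  obtain ⟨e, he⟩ := hθ.exists_mul_zpow_ne_odd hθ2 hD
  refine ⟨D * 2 ^ e, by positivity, dvd_mul_right _ _, ?_⟩
  have hmem : ((D * 2 ^ e : ℕ) : ℝ) ∈ pisotModule θ := by
    simpa using nsmul_mem hθ.one_mem_pisotModule (D * 2 ^ e)
  refine tprod_ne_zero_of_summable_abs_sub_one (summable_abs_cos_pisot hθ.1 hmem) fun j hj => ?_
  obtain ⟨k, hk⟩ := Real.cos_eq_zero_iff.1 hj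
  refine he j k ?_
  have := Real.pi_ne_zero
  field_simp at hk
  linarith

/-! ### Infinitely many accumulation points -/

/-- The closure of the two-sided products at admissible points is stable under multiplication by
`w`. Hence `wᵏ W(ξ ± ξ θᴺ)` stays in it and tends to `wᵏ⁺²`, and one of the two signs avoids the
limit. -/
theorem IsPisot.exists_powers_mem_derivedSet {θ r : ℝ} (hθ : IsPisot θ) (hθ2 : θ ≠ 2) (hr : r ≠ 0)
    (hrmem : r ∈ IntermediateField.adjoin ℚ ({θ} : Set ℝ)) :
    ∃ w : ℝ, w ≠ 0 ∧ |w| < 1 ∧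
      ∀ k : ℕ, w ^ (k + 2) ∈ derivedSet (Set.range fun n : ℤ => cosProduct θ (r * n)) := by
  obtain ⟨D, hD, p, hp⟩ := exists_natCast_mul_eq_aeval hθ.isIntegral_rat.isAlgebraic
    (inv_mem hrmem)
  obtain ⟨c, hc0, ⟨d, rfl⟩, hc⟩ := hθ.exists_biCosProduct_ne_zero hθ2 hD
  set ξ : ℝ := ((D * d : ℕ) : ℝ) with hξ
  set w := biCosProduct θ ξ with hw
  have hξ0 : 0 < ξ := by positivity
  have h1 : ξ ∈ pisotModule θ := by
    simpa [hξ] using nsmul_mem hθ.one_mem_pisotModule (D * d)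
  have h2 : ξ / r ∈ pisotModule θ := by
    have : ξ / r = d • Polynomial.aeval θ p := by
      rw [← hp, hξ, nsmul_eq_mul]
      push_cast
      ring
    rw [this]
    exact nsmul_mem (hθ.aeval_mem_pisotModule p) d
  set S := closure (Set.range fun n : ℤ => cosProduct θ (r * n)) with hS
  set G : Set ℝ := biCosProduct θ '' {η | η ∈ pisotModule θ ∧ η / r ∈ pisotModule θ} with hG
  have hGS : closure G ⊆ S := by
    refine closure_minimal ?_ isClosed_closure
    rintro _ ⟨η, ⟨hη, hη'⟩, rfl⟩
    exact biCosProduct_mem_closure hθ.1 hr hη hη'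
  have hmulG : ∀ x ∈ closure G, w * x ∈ closure G := by
    intro x hx
    have hmaps : MapsTo (fun x => w * x) G (closure G) := by
      rintro _ ⟨η, ⟨hη, hη'⟩, rfl⟩
      refine mem_closure_of_tendsto (tendsto_biCosProduct_add_mul_pow hθ.1 h1 hη)
        (Eventually.of_forall fun N => ⟨_, ⟨?_, ?_⟩, rfl⟩)
      · exact add_mem h1 (mul_pow_mem_pisotModule hη N)
      · rw [add_div, mul_div_right_comm]
        exact add_mem h2 (mul_pow_mem_pisotModule hη' N)
    have := hmaps.closure (continuous_const_mul w) hx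
    rwa [closure_closure] at this
  have hpowG : ∀ k : ℕ, ∀ x ∈ closure G, w ^ k * x ∈ closure G := by
    intro k x hx
    induction k with
    | zero => simpa using hx
    | succ k ih =>
      rw [pow_succ', mul_assoc]
      exact hmulG _ ih
  refine ⟨w, hc, abs_biCosProduct_lt_one hθ.1 h1 hξ0, fun k => ?_⟩
  -- Taking the closure does not change the derived set, so approximating points need only lie in
  -- `S`.
  rw [← derivedSet_closure, mem_derivedSet, accPt_iff_frequently]
  have hwk : w ^ k ≠ 0 := pow_ne_zero _ hc
  have hlim : ∀ η : ℝ, η ∈ pisotModule θ → biCosProduct θ η = w →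
      Tendsto (fun N : ℕ => w ^ k * biCosProduct θ (ξ + η * θ ^ N)) atTop (𝓝 (w ^ (k + 2))) := by
    intro η hη hηw
    have := (tendsto_biCosProduct_add_mul_pow hθ.1 h1 hη).const_mul (w ^ k)
    rw [hηw] at this
    convert this using 2
    ring
  have hneg : biCosProduct θ (-ξ) = w := by
    rw [hw, biCosProduct, biCosProduct]
    refine tprod_congr fun j => ?_
    rw [neg_mul, mul_neg, Real.cos_neg]
  have hmem : ∀ η : ℝ, η ∈ pisotModule θ → η / r ∈ pisotModule θ → ∀ N : ℕ,
      w ^ k * biCosProduct θ (ξ + η * θ ^ N) ∈ S := by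
    intro η hη hη' N
    refine hGS (hpowG k _ (subset_closure ⟨_, ⟨?_, ?_⟩, rfl⟩))
    · exact add_mem h1 (mul_pow_mem_pisotModule hη N)
    · rw [add_div, mul_div_right_comm]
      exact add_mem h2 (mul_pow_mem_pisotModule hη' N)
  rw [frequently_iff]
  intro U hU
  obtain ⟨N, ⟨hN1, hN2⟩, hN3⟩ := (((hlim ξ h1 rfl).eventually hU).and
    ((hlim (-ξ) (neg_mem h1) hneg).eventually hU) |>.and
    (eventually_biCosProduct_ne hθ.1 h1 hξ0 hc)).exists
  have hne : ∀ y, y ≠ w ^ 2 → w ^ k * y ≠ w ^ (k + 2) := by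
    intro y hy h
    rw [pow_add] at h
    exact hy (mul_left_cancel₀ hwk h)
  rcases hN3 with h | h
  · exact ⟨_, hN1, hne _ h, hmem ξ h1 h2 N⟩
  · exact ⟨_, hN2, hne _ h, hmem (-ξ) (neg_mem h1) (by rw [neg_div]; exact neg_mem h2) N⟩

theorem IsPisot.infinite_derivedSet {θ r : ℝ} (hθ : IsPisot θ) (hθ2 : θ ≠ 2) (hr : r ≠ 0)
    (hrmem : r ∈ IntermediateField.adjoin ℚ ({θ} : Set ℝ)) :
    (derivedSet (Set.range fun n : ℤ => cosProduct θ (r * n))).Infinite := by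
  obtain ⟨w, hw0, hw1, hw⟩ := hθ.exists_powers_mem_derivedSet hθ2 hr hrmem
  refine Set.infinite_of_injective_forall_mem (f := fun k : ℕ => w ^ (k + 2)) (fun a b h => ?_) hw
  have h1 : |w| ^ (a + 2) = |w| ^ (b + 2) := by
    simp only at h
    rw [← abs_pow, ← abs_pow, h]
  have := pow_right_injective₀ (abs_pos.2 hw0) hw1.ne h1
  omega

/-! ### Linear recurrences with integer coefficients -/

/-- The shift operator on two-sided complex sequences. -/
def shiftEnd : Module.End ℂ (ℤ → ℂ) where
  toFun v k := v (k + 1)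
  map_add' _ _ := rfl
  map_smul' _ _ := rfl

theorem shiftEnd_pow_apply (v : ℤ → ℂ) (i : ℕ) (k : ℤ) : (shiftEnd ^ i) v k = v (k + i) := by
  induction i generalizing k with
  | zero => simp
  | succ i ih =>
    rw [pow_succ', Module.End.mul_apply]
    change (shiftEnd ^ i) v (k + 1) = _
    rw [ih]
    congr 1
    push_cast
    ring

theorem aeval_shiftEnd_apply (P : Polynomial ℂ) (v : ℤ → ℂ) (k : ℤ) :
    Polynomial.aeval shiftEnd P v k =
      ∑ i ∈ Finset.range (P.natDegree + 1), P.coeff i * v (k + i) := by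
  rw [Polynomial.aeval_eq_sum_range, LinearMap.sum_apply, Finset.sum_apply]
  refine Finset.sum_congr rfl fun i _ => ?_
  rw [LinearMap.smul_apply, Pi.smul_apply, shiftEnd_pow_apply, smul_eq_mul]

theorem aeval_shiftEnd_one_sub (α : ℂ) (v : ℤ → ℂ) (k : ℤ) :
    Polynomial.aeval shiftEnd (1 - Polynomial.C α * Polynomial.X) v k = v k - α * v (k + 1) := by
  simp [shiftEnd, Algebra.algebraMap_eq_smul_one]

/-- The operator `∑ qᵢ σⁱ` on two-sided real sequences, where `σ` is the shift and the `qᵢ` are the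
coefficients of an integer polynomial. -/
noncomputable def recOp (Q : Polynomial ℤ) (e : ℤ → ℝ) (k : ℤ) : ℝ :=
  ∑ i ∈ Finset.range (Q.natDegree + 1), (Q.coeff i : ℝ) * e (k + i)

theorem aeval_shiftEnd_map_apply (Q : Polynomial ℤ) (v : ℤ → ℂ) (k : ℤ) :
    Polynomial.aeval shiftEnd (Q.map (Int.castRingHom ℂ)) v k =
      ∑ i ∈ Finset.range (Q.natDegree + 1), (Q.coeff i : ℂ) * v (k + i) := by
  rw [aeval_shiftEnd_apply, Polynomial.natDegree_map_eq_of_injective Int.cast_injective]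
  simp

theorem ofReal_recOp (Q : Polynomial ℤ) (e : ℤ → ℝ) (k : ℤ) :
    (recOp Q e k : ℂ) =
      Polynomial.aeval shiftEnd (Q.map (Int.castRingHom ℂ)) (fun j => (e j : ℂ)) k := by
  rw [aeval_shiftEnd_map_apply, recOp]
  push_cast
  rfl

theorem recOp_sub (Q : Polynomial ℤ) (e f : ℤ → ℝ) (k : ℤ) :
    recOp Q (e - f) k = recOp Q e k - recOp Q f k := by
  simp [recOp, mul_sub, Finset.sum_sub_distrib]

theorem continuous_recOp (Q : Polynomial ℤ) (k : ℤ) :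
    Continuous fun e : ℤ → ℝ => recOp Q e k := by
  unfold recOp
  fun_prop

/-- The Neumann series `hₖ = ∑ αʲ fₖ₊ⱼ` inverts `1 - α σ` on summable sequences. -/
theorem exists_summable_sub_mul_shift_of_lt {α : ℂ} (hα : ‖α‖ < 1) {f : ℤ → ℂ}
    (hf : Summable fun k => ‖f k‖) :
    ∃ h : ℤ → ℂ, (Summable fun k => ‖h k‖) ∧ ∀ k, h k - α * h (k + 1) = f k := by
  have hgeo : Summable fun j : ℕ => ‖α‖ ^ j := summable_geometric_of_lt_one (norm_nonneg _) hα
  let E : ℤ × ℕ ≃ ℤ × ℕ :=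
    { toFun := fun p => (p.1 + p.2, p.2)
      invFun := fun p => (p.1 - p.2, p.2)
      left_inv := fun p => by simp
      right_inv := fun p => by simp }
  have hprod : Summable fun p : ℤ × ℕ => ‖α‖ ^ p.2 * ‖f (p.1 + p.2)‖ := by
    have h1 : Summable fun p : ℤ × ℕ => ‖f p.1‖ * ‖α‖ ^ p.2 :=
      hf.mul_of_nonneg hgeo (fun _ => norm_nonneg _) (fun _ => by positivity)
    refine (E.summable_iff.2 h1).congr fun p => ?_
    exact mul_comm _ _
  have hrow : ∀ k : ℤ, Summable fun j : ℕ => ‖α ^ j * f (k + j)‖ := fun k =>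
    (hprod.prod_factor k).congr fun j => by rw [norm_mul, norm_pow]
  refine ⟨fun k => ∑' j : ℕ, α ^ j * f (k + j), ?_, fun k => ?_⟩
  · refine hprod.prod.of_nonneg_of_le (fun _ => norm_nonneg _) fun k => ?_
    refine (norm_tsum_le_tsum_norm (hrow k)).trans_eq (tsum_congr fun j => ?_)
    rw [norm_mul, norm_pow]
  · have h1 : Summable fun j : ℕ => α ^ j * f (k + j) := (hrow k).of_norm
    beta_reduce
    rw [h1.tsum_eq_zero_add, ← tsum_mul_left]
    have h2 : ∀ j : ℕ, α * (α ^ j * f (k + 1 + j)) = α ^ (j + 1) * f (k + (j + 1 : ℕ)) := by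
      intro j
      rw [pow_succ']
      push_cast
      rw [add_assoc, add_comm (1 : ℤ), mul_assoc]
    simp_rw [h2]
    simp

theorem exists_summable_sub_mul_shift {α : ℂ} (hα : ‖α‖ ≠ 1) {f : ℤ → ℂ}
    (hf : Summable fun k => ‖f k‖) :
    ∃ h : ℤ → ℂ, (Summable fun k => ‖h k‖) ∧ ∀ k, h k - α * h (k + 1) = f k := by
  rcases hα.lt_or_gt with hα | hα
  · exact exists_summable_sub_mul_shift_of_lt hα hf
  · have hα0 : α ≠ 0 := by
      rintro rfl
      simp at hα
      linarith
    have hβ : ‖α⁻¹‖ < 1 := by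
      rw [norm_inv]
      exact inv_lt_one_of_one_lt₀ hα
    obtain ⟨h, hh, hrec⟩ := exists_summable_sub_mul_shift_of_lt hβ
      (f := fun k => f (-k)) ((Equiv.neg ℤ).summable_iff.2 hf)
    -- Reflection `k ↦ -k` reverses the shift and replaces `α` by `α⁻¹`, reducing to a contraction.
    refine ⟨fun k => -α⁻¹ * h (-k + 1), ?_, fun k => ?_⟩
    · have h1 : Summable fun k : ℤ => ‖h (-k + 1)‖ :=
        hh.comp_injective (i := fun k : ℤ => -k + 1) fun a b hab => by simpa using hab
      refine (h1.mul_left ‖α⁻¹‖).congr fun k => ?_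
      rw [norm_mul, norm_neg]
    · have h2 := hrec (-k)
      rw [neg_neg] at h2
      have h3 : -(k + 1) + 1 = -k := by ring
      beta_reduce
      rw [h3, ← h2]
      field_simp
      ring

theorem exists_green_complex (s : Multiset ℂ) (hs : ∀ α ∈ s, ‖α‖ ≠ 1) {f : ℤ → ℂ}
    (hf : Summable fun k => ‖f k‖) :
    ∃ g : ℤ → ℂ, (Summable fun k => ‖g k‖) ∧ Polynomial.aeval shiftEnd
      (s.map fun α => 1 - Polynomial.C α * Polynomial.X).prod g = f := by
  induction s using Multiset.induction_on generalizing f with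
  | empty => exact ⟨f, hf, by simp⟩
  | cons α s ih =>
    obtain ⟨h, hh, hrec⟩ := exists_summable_sub_mul_shift (hs α (Multiset.mem_cons_self α s)) hf
    obtain ⟨g, hg, hgrec⟩ := ih (fun β hβ => hs β (Multiset.mem_cons_of_mem hβ)) hh
    refine ⟨g, hg, ?_⟩
    rw [Multiset.map_cons, Multiset.prod_cons, map_mul, Module.End.mul_apply, hgrec]
    ext k
    rw [aeval_shiftEnd_one_sub, hrec]

/-- Each factor gives `vₖ = α vₖ₊₁`, so `vₖ = αⁿ vₖ₊ₙ → 0` for bounded `v`. Only forward indices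
enter, so conditions on the half-line suffice. -/
theorem eq_zero_of_aeval_shiftEnd_eq_zero (s : Multiset ℂ) (hs : ∀ α ∈ s, ‖α‖ < 1) {v : ℤ → ℂ}
    {R : ℝ} (hv : ∀ k, ‖v k‖ ≤ R)
    (h : ∀ k, 0 ≤ k → Polynomial.aeval shiftEnd
      (s.map fun α => 1 - Polynomial.C α * Polynomial.X).prod v k = 0) :
    ∀ k, 0 ≤ k → v k = 0 := by
  induction s using Multiset.induction_on generalizing v R with
  | empty => simpa using h
  | cons α s ih =>
    have hα := hs α (Multiset.mem_cons_self α s)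
    have h1 : ∀ k, 0 ≤ k → v k = α * v (k + 1) := by
      intro k hk
      have := ih (fun β hβ => hs β (Multiset.mem_cons_of_mem hβ))
        (v := Polynomial.aeval shiftEnd (1 - Polynomial.C α * Polynomial.X) v)
        (R := R + ‖α‖ * R) (fun k => ?_) (fun k hk => ?_) k hk
      · rw [aeval_shiftEnd_one_sub, sub_eq_zero] at this
        exact this
      · rw [aeval_shiftEnd_one_sub]
        refine (norm_sub_le _ _).trans (add_le_add (hv k) ?_)
        rw [norm_mul]
        exact mul_le_mul_of_nonneg_left (hv _) (norm_nonneg _)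
      · rw [← h k hk, Multiset.map_cons, Multiset.prod_cons,
          mul_comm (1 - Polynomial.C α * Polynomial.X), map_mul, Module.End.mul_apply]
    intro k hk
    have h2 : ∀ n : ℕ, v k = α ^ n * v (k + n) := by
      intro n
      induction n with
      | zero => simp
      | succ n ihn =>
        rw [ihn, h1 (k + n) (by omega), pow_succ, mul_assoc]
        push_cast
        rw [add_assoc]
    have h3 : Tendsto (fun n : ℕ => ‖α‖ ^ n * R) atTop (𝓝 0) := by
      simpa using (tendsto_pow_atTop_nhds_zero_of_lt_one (norm_nonneg _) hα).mul_const R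
    have h4 : ‖v k‖ ≤ 0 := by
      refine ge_of_tendsto' h3 fun n => ?_
      rw [h2 n, norm_mul, norm_pow]
      exact mul_le_mul_of_nonneg_left (hv _) (by positivity)
    exact norm_le_zero_iff.1 h4

theorem Polynomial.reverse_one : (1 : Polynomial ℂ).reverse = 1 := by
  simpa using Polynomial.reverse_C (1 : ℂ)

theorem Polynomial.reverse_X_sub_C (α : ℂ) :
    (Polynomial.X - Polynomial.C α).reverse = 1 - Polynomial.C α * Polynomial.X := by
  have h : (Polynomial.X - Polynomial.C α) = 1 * Polynomial.X + Polynomial.C (-α) := by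
    rw [map_neg]; ring
  rw [h, Polynomial.reverse_add_C, Polynomial.reverse_mul_X, Polynomial.reverse_one, one_mul,
    Polynomial.natDegree_X, pow_one, map_neg]
  ring

theorem Polynomial.reverse_prod_X_sub_C (s : Multiset ℂ) :
    (s.map fun α => Polynomial.X - Polynomial.C α).prod.reverse =
      (s.map fun α => 1 - Polynomial.C α * Polynomial.X).prod := by
  induction s using Multiset.induction_on with
  | empty => simp [Polynomial.reverse_one]
  | cons α s ih =>
    rw [Multiset.map_cons, Multiset.prod_cons, Polynomial.reverse_mul_of_domain, ih,
      Polynomial.reverse_X_sub_C, Multiset.map_cons, Multiset.prod_cons]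

/-- The minimal polynomial is reversed because the relevant sequences are `θ⁻ᵏ`; its roots become
the multipliers `α` in the factors `1 - α σ`. -/
theorem IsPisot.exists_recurrence {θ : ℝ} (hθ : IsPisot θ) :
    ∃ (Q : Polynomial ℤ) (s : Multiset ℂ), Q.map (Int.castRingHom ℂ) =
      (1 - Polynomial.C (θ : ℂ) * Polynomial.X) *
        (s.map fun α => 1 - Polynomial.C α * Polynomial.X).prod ∧ ∀ α ∈ s, ‖α‖ < 1 := by
  obtain ⟨s, hs, hs1⟩ := hθ.exists_roots
  refine ⟨(minpoly ℤ θ).reverse, s, ?_, hs1⟩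
  have h1 : (minpoly ℤ θ).map (Int.castRingHom ℂ) = (minpoly ℚ θ).map (algebraMap ℚ ℂ) := by
    rw [minpoly.isIntegrallyClosed_eq_field_fractions' ℚ hθ.2.1, Polynomial.map_map]
    congr 1
  have h2 : (minpoly ℤ θ).reverse.map (Int.castRingHom ℂ) =
      ((minpoly ℤ θ).map (Int.castRingHom ℂ)).reverse := by
    rw [Polynomial.reverse, Polynomial.reverse, Polynomial.reflect_map,
      Polynomial.natDegree_map_eq_of_injective Int.cast_injective]
  rw [h2, h1, hs, Polynomial.reverse_mul_of_domain, Polynomial.reverse_X_sub_C,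
    Polynomial.reverse_prod_X_sub_C]

section Pisot

variable {θ : ℝ} {Q : Polynomial ℤ} {s : Multiset ℂ}

/-- No multiplier has modulus one, so each factor can be inverted on summable sequences, starting
from the unit mass at zero. Taking real parts is harmless because `Q` has integer coefficients. -/
theorem exists_green (hθ : 1 < θ)
    (hQ : Q.map (Int.castRingHom ℂ) = (1 - Polynomial.C (θ : ℂ) * Polynomial.X) *
        (s.map fun α => 1 - Polynomial.C α * Polynomial.X).prod) (hs : ∀ α ∈ s, ‖α‖ < 1) :
    ∃ g : ℤ → ℝ, (Summable fun k => |g k|) ∧ ∀ k, recOp Q g k = if k = 0 then 1 else 0 := by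
  have hδ : Summable fun k : ℤ => ‖(if k = 0 then 1 else 0 : ℂ)‖ :=
    summable_of_ne_finset_zero (s := {0}) fun k hk => by
      rw [if_neg (by simpa using hk), norm_zero]
  obtain ⟨g, hg, hrec⟩ := exists_green_complex ((θ : ℂ) ::ₘ s) (fun α hα => by
    rcases Multiset.mem_cons.1 hα with rfl | hα
    · rw [Complex.norm_real, Real.norm_of_nonneg (by linarith)]
      exact hθ.ne'
    · exact (hs α hα).ne) hδ
  rw [Multiset.map_cons, Multiset.prod_cons, ← hQ] at hrec
  refine ⟨fun k => (g k).re, hg.of_nonneg_of_le (fun _ => abs_nonneg _)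
    fun k => Complex.abs_re_le_norm _, fun k => ?_⟩
  have h1 := congrArg Complex.re (congrFun hrec k)
  rw [aeval_shiftEnd_map_apply, Complex.re_sum] at h1
  rw [recOp]
  convert h1 using 1
  · refine Finset.sum_congr rfl fun i _ => ?_
    simp
  · split_ifs <;> simp

/-- The factors with `‖α‖ < 1` have no bounded kernel on the half-line; removing them leaves `eₖ = θ
eₖ₊₁`. -/
theorem eq_mul_inv_pow_of_recOp_eq_zero (hθ : 1 < θ)
    (hQ : Q.map (Int.castRingHom ℂ) = (1 - Polynomial.C (θ : ℂ) * Polynomial.X) *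
        (s.map fun α => 1 - Polynomial.C α * Polynomial.X).prod) (hs : ∀ α ∈ s, ‖α‖ < 1)
    {e : ℤ → ℝ} {R : ℝ} (he : ∀ k, |e k| ≤ R) (h : ∀ k, 0 ≤ k → recOp Q e k = 0) (n : ℕ) :
    e n = e 0 * θ⁻¹ ^ n := by
  have h1 := eq_zero_of_aeval_shiftEnd_eq_zero s hs
    (v := Polynomial.aeval shiftEnd (1 - Polynomial.C (θ : ℂ) * Polynomial.X) fun j => (e j : ℂ))
    (R := R + θ * R) (fun k => by
      rw [aeval_shiftEnd_one_sub, ← Complex.ofReal_mul, ← Complex.ofReal_sub, Complex.norm_real,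
        Real.norm_eq_abs]
      refine (abs_sub _ _).trans (add_le_add (he k) ?_)
      rw [abs_mul, abs_of_pos (by linarith)]
      exact mul_le_mul_of_nonneg_left (he _) (by linarith)) (fun k hk => by
      have := congrArg Complex.ofReal (h k hk)
      rw [ofReal_recOp, hQ, mul_comm, map_mul, Module.End.mul_apply] at this
      simpa using this)
  induction n with
  | zero => simp
  | succ n ih =>
    have h2 := h1 n (by omega)
    rw [aeval_shiftEnd_one_sub, ← Complex.ofReal_mul, ← Complex.ofReal_sub,
      Complex.ofReal_eq_zero, sub_eq_zero] at h2
    rw [pow_succ, ← mul_assoc, ← ih, h2]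
    have : θ ≠ 0 := by positivity
    push_cast
    field_simp

theorem sum_coeff_mul_inv_pow_eq_zero (hθ : 1 < θ)
    (hQ : Q.map (Int.castRingHom ℂ) = (1 - Polynomial.C (θ : ℂ) * Polynomial.X) *
        (s.map fun α => 1 - Polynomial.C α * Polynomial.X).prod) :
    ∑ i ∈ Finset.range (Q.natDegree + 1), (Q.coeff i : ℝ) * θ⁻¹ ^ i = 0 := by
  have h := congrArg (Polynomial.eval ((θ⁻¹ : ℝ) : ℂ)) hQ
  have hθ0 : (θ : ℂ) ≠ 0 := by exact_mod_cast (by positivity : θ ≠ 0)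
  rw [Polynomial.eval_mul, Polynomial.eval_sub, Polynomial.eval_mul, Polynomial.eval_C,
    Polynomial.eval_X, Polynomial.eval_one, Complex.ofReal_inv, mul_inv_cancel₀ hθ0, sub_self,
    zero_mul, Polynomial.eval_eq_sum_range,
    Polynomial.natDegree_map_eq_of_injective Int.cast_injective] at h
  rw [← Complex.ofReal_eq_zero, ← h]
  push_cast
  simp

end Pisot

/-! ### Convolution with a Green function -/

/-- Convolution of two-sided real sequences. -/
noncomputable def seqConv (g d : ℤ → ℝ) (k : ℤ) : ℝ := ∑' j, g (k - j) * d j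

section Green

variable {Q : Polynomial ℤ} {g : ℤ → ℝ}

theorem abs_tsum_le_tsum_abs {ι : Type*} {f : ι → ℝ} (hf : Summable fun i => |f i|) :
    |∑' i, f i| ≤ ∑' i, |f i| := by
  simpa only [Real.norm_eq_abs] using
    norm_tsum_le_tsum_norm (f := f) (by simpa only [Real.norm_eq_abs] using hf)

theorem summable_seqConv_term (hg : Summable fun k => |g k|) {d : ℤ → ℝ} {R : ℝ}
    (hd : ∀ k, |d k| ≤ R) (k : ℤ) : Summable fun j => |g (k - j) * d j| := by
  have h1 : Summable fun j : ℤ => |g (k - j)| :=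
    hg.comp_injective (i := fun j : ℤ => k - j) fun a b hab => by simpa using hab
  refine (h1.mul_right R).of_nonneg_of_le (fun _ => abs_nonneg _) fun j => ?_
  rw [abs_mul]
  exact mul_le_mul_of_nonneg_left (hd j) (abs_nonneg _)

theorem abs_seqConv_le (hg : Summable fun k => |g k|) {d : ℤ → ℝ} {R : ℝ}
    (hd : ∀ k, |d k| ≤ R) (k : ℤ) : |seqConv g d k| ≤ (∑' j, |g j|) * R := by
  have h1 : Summable fun j : ℤ => |g (k - j)| :=
    hg.comp_injective (i := fun j : ℤ => k - j) fun a b hab => by simpa using hab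
  have hs := summable_seqConv_term hg hd k
  refine (abs_tsum_le_tsum_abs hs).trans ?_
  refine (hs.tsum_le_tsum (g := fun j => |g (k - j)| * R) (fun j => ?_) (h1.mul_right R)).trans_eq ?_
  · rw [abs_mul]
    exact mul_le_mul_of_nonneg_left (hd j) (abs_nonneg _)
  · rw [tsum_mul_right, ← (Equiv.subLeft k).tsum_eq fun j => |g j|]
    rfl

theorem summable_prod_seqConv (hg : Summable fun k => |g k|) {d : ℤ → ℝ}
    (hd : Summable fun k => |d k|) : Summable fun p : ℤ × ℤ => |g (p.1 - p.2)| * |d p.2| := by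
  have h1 : Summable fun p : ℤ × ℤ => |g p.1| * |d p.2| :=
    hg.mul_of_nonneg hd (fun _ => abs_nonneg _) (fun _ => abs_nonneg _)
  refine h1.comp_injective (i := fun p : ℤ × ℤ => (p.1 - p.2, p.2)) ?_
  rintro ⟨a, b⟩ ⟨a', b'⟩ h
  simp only [Prod.mk.injEq] at h ⊢
  omega

theorem summable_seqConv (hg : Summable fun k => |g k|) {d : ℤ → ℝ}
    (hd : Summable fun k => |d k|) :
    (Summable fun k => |seqConv g d k|) ∧
      ∑' k, |seqConv g d k| ≤ (∑' k, |g k|) * ∑' k, |d k| := by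
  have hprod := summable_prod_seqConv hg hd
  have hle : ∀ k, |seqConv g d k| ≤ ∑' j, |g (k - j)| * |d j| := by
    intro k
    have h1 : Summable fun j => |g (k - j) * d j| := by
      simp_rw [abs_mul]
      exact hprod.prod_factor k
    refine (abs_tsum_le_tsum_abs h1).trans_eq ?_
    simp_rw [abs_mul]
  have hrow : Summable fun k => ∑' j, |g (k - j)| * |d j| := hprod.prod
  have hs : Summable fun k => |seqConv g d k| :=
    hrow.of_nonneg_of_le (fun _ => abs_nonneg _) hle
  refine ⟨hs, (hs.tsum_le_tsum hle hrow).trans_eq ?_⟩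
  have hcomm : ∑' k, ∑' j, |g (k - j)| * |d j| = ∑' j, ∑' k, |g (k - j)| * |d j| :=
    (Summable.tsum_comm (f := fun k j => |g (k - j)| * |d j|) hprod).symm
  rw [hcomm, ← tsum_mul_left]
  refine tsum_congr fun j => ?_
  rw [tsum_mul_right]
  congr 1
  exact (Equiv.subRight j).tsum_eq fun j => |g j|

theorem recOp_seqConv (hg : Summable fun k => |g k|)
    (hgreen : ∀ k, recOp Q g k = if k = 0 then 1 else 0) {d : ℤ → ℝ} {R : ℝ}
    (hd : ∀ k, |d k| ≤ R) (k : ℤ) : recOp Q (seqConv g d) k = d k := by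
  have hs : ∀ i : ℕ, Summable fun j => (Q.coeff i : ℝ) * (g (k + i - j) * d j) := fun i =>
    ((summable_seqConv_term hg hd (k + i)).of_abs).mul_left _
  have h1 : recOp Q (seqConv g d) k = ∑' j, recOp Q g (k - j) * d j := by
    simp only [recOp, seqConv]
    simp_rw [← tsum_mul_left]
    rw [← Summable.tsum_finsetSum fun i _ => hs i]
    refine tsum_congr fun j => ?_
    rw [Finset.sum_mul]
    refine Finset.sum_congr rfl fun i _ => ?_
    rw [sub_add_eq_add_sub, mul_assoc]
  rw [h1, tsum_eq_single k]
  · simp [hgreen]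
  · intro j hj
    rw [hgreen, if_neg (by omega), zero_mul]

/-- Moving the operator from `e` onto `g` produces the unit mass. Thus a bounded sequence is
determined by its image, which for the sequences of interest is integer data. -/
theorem seqConv_recOp (hg : Summable fun k => |g k|)
    (hgreen : ∀ k, recOp Q g k = if k = 0 then 1 else 0) {e : ℤ → ℝ} {R : ℝ}
    (he : ∀ k, |e k| ≤ R) (k : ℤ) : seqConv g (recOp Q e) k = e k := by
  have hs : ∀ i : ℕ, Summable fun j => (Q.coeff i : ℝ) * (g (k - j) * e (j + i)) := fun i =>
    ((summable_seqConv_term hg (d := fun j => e (j + i)) (fun j => he _) k).of_abs).mul_left _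
  have hs' : ∀ i : ℕ, Summable fun j => (Q.coeff i : ℝ) * (g (k - j + i) * e j) := by
    intro i
    refine (((summable_seqConv_term hg he (k + i)).of_abs).mul_left (Q.coeff i : ℝ)).congr
      fun j => ?_
    rw [sub_add_eq_add_sub]
  have h1 : seqConv g (recOp Q e) k = ∑' j, recOp Q g (k - j) * e j := by
    simp only [recOp, seqConv]
    simp_rw [Finset.mul_sum, Finset.sum_mul]
    have e1 : ∀ (j : ℤ) (i : ℕ), g (k - j) * ((Q.coeff i : ℝ) * e (j + i)) =
      (Q.coeff i : ℝ) * (g (k - j) * e (j + i)) := fun j i => by ring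
    simp_rw [e1, mul_assoc]
    rw [Summable.tsum_finsetSum fun i _ => hs i, Summable.tsum_finsetSum fun i _ => hs' i]
    refine Finset.sum_congr rfl fun i _ => ?_
    rw [← (Equiv.addRight (i : ℤ)).tsum_eq fun j => (Q.coeff i : ℝ) * (g (k - j + i) * e j)]
    refine tsum_congr fun j => ?_
    rw [Equiv.coe_addRight]
    congr 3
    ring
  rw [h1, tsum_eq_single k]
  · simp [hgreen]
  · intro j hj
    rw [hgreen, if_neg (by omega), zero_mul]

end Green

/-! ### Integer-valued sequences -/

/-- A real sequence is integer-valued. -/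
def IntValued (d : ℤ → ℝ) : Prop := ∀ k, ∃ n : ℤ, d k = n

theorem one_le_intCast_sq {n : ℤ} (hn : n ≠ 0) : (1 : ℝ) ≤ (n : ℝ) ^ 2 := by
  have h : 0 < n ^ 2 := by positivity
  exact_mod_cast h

theorem finite_support_of_intValued {d : ℤ → ℝ} (hd : IntValued d)
    (h : Tendsto (fun k => d k ^ 2) cofinite (𝓝 0)) : (Function.support d).Finite := by
  have h1 := h.eventually_lt_const (show (0 : ℝ) < 1 by norm_num)
  rw [eventually_cofinite] at h1
  refine h1.subset fun k hk => ?_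
  obtain ⟨n, hn⟩ := hd k
  rw [Function.mem_support, hn] at hk
  simp only [mem_ofPred_eq, not_lt, hn]
  exact one_le_intCast_sq (by exact_mod_cast hk)

theorem finite_support_of_sum_sq_le {d : ℤ → ℝ} (hd : IntValued d) {M : ℝ}
    (h : ∀ F : Finset ℤ, ∑ k ∈ F, d k ^ 2 ≤ M) : (Function.support d).Finite :=
  finite_support_of_intValued hd
    (summable_of_sum_le (fun k => sq_nonneg (d k)) h).tendsto_cofinite_zero

theorem summable_abs_of_finite_support {d : ℤ → ℝ} (h : (Function.support d).Finite) :
    Summable fun k => |d k| :=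
  summable_of_ne_finset_zero (s := h.toFinset) fun k hk => by
    simpa using hk

theorem exists_finsupp_eq {d : ℤ → ℝ} (hd : IntValued d) (h : (Function.support d).Finite) :
    ∃ n : ℤ →₀ ℤ, d = fun k => (n k : ℝ) := by
  choose n hn using hd
  refine ⟨Finsupp.ofSupportFinite n (h.subset fun k hk => ?_), ?_⟩
  · rw [Function.mem_support, hn]
    exact_mod_cast hk
  · ext k
    exact hn k

theorem abs_le_of_sum_sq_le {d : ℤ → ℝ} (hd : IntValued d) {M : ℝ}
    (h : ∀ F : Finset ℤ, ∑ k ∈ F, d k ^ 2 ≤ M) (k : ℤ) : |d k| ≤ M := by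
  have h1 : d k ^ 2 ≤ M := by simpa using h {k}
  refine le_trans ?_ h1
  obtain ⟨n, hn⟩ := hd k
  rw [hn]
  have : |n| ≤ n ^ 2 := by
    rcases eq_or_ne n 0 with rfl | hn0
    · simp
    · rw [← sq_abs, sq]
      exact le_mul_of_one_le_left (abs_nonneg n) (Int.one_le_abs hn0)
  exact_mod_cast this

theorem IntValued.tendsto {α : Type*} {l : Filter α} [l.NeBot] {d : α → ℤ → ℝ} {d' : ℤ → ℝ}
    (hd : ∀ᶠ a in l, IntValued (d a)) (h : ∀ k, Tendsto (fun a => d a k) l (𝓝 (d' k))) :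
    IntValued d' := by
  intro k
  have : d' k ∈ Set.range ((↑) : ℤ → ℝ) := by
    refine Int.isClosedEmbedding_coe_real.isClosed_range.mem_of_tendsto (h k) ?_
    filter_upwards [hd] with a ha
    obtain ⟨n, hn⟩ := ha k
    exact ⟨n, hn.symm⟩
  obtain ⟨n, hn⟩ := this
  exact ⟨n, hn.symm⟩

theorem IntValued.eventually_eq {α : Type*} {l : Filter α} [l.NeBot] {d : α → ℤ → ℝ}
    {d' : ℤ → ℝ} (hd : ∀ᶠ a in l, IntValued (d a))
    (h : ∀ k, Tendsto (fun a => d a k) l (𝓝 (d' k))) (k : ℤ) : ∀ᶠ a in l, d a k = d' k := by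
  obtain ⟨m, hm⟩ := IntValued.tendsto hd h k
  filter_upwards [hd, Metric.tendsto_nhds.1 (h k) 1 one_pos] with a ha hlt
  obtain ⟨n, hn⟩ := ha k
  rw [hn, hm, Real.dist_eq] at hlt
  rw [hn, hm]
  have : |n - m| < 1 := by exact_mod_cast hlt
  rw [Int.abs_lt_one_iff, sub_eq_zero] at this
  rw [this]

theorem IntValued.sub {d d' : ℤ → ℝ} (h : IntValued d) (h' : IntValued d') :
    IntValued (d - d') := by
  intro k
  obtain ⟨n, hn⟩ := h k
  obtain ⟨m, hm⟩ := h' k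
  exact ⟨n - m, by simp [hn, hm]⟩

theorem sum_sq_le_of_tendsto {α : Type*} {l : Filter α} [l.NeBot] {d : α → ℤ → ℝ} {d' : ℤ → ℝ}
    {M : ℝ} (hM : ∀ᶠ a in l, ∀ F : Finset ℤ, ∑ k ∈ F, d a k ^ 2 ≤ M)
    (h : ∀ k, Tendsto (fun a => d a k) l (𝓝 (d' k))) (F : Finset ℤ) :
    ∑ k ∈ F, d' k ^ 2 ≤ M := by
  refine le_of_tendsto (tendsto_finsetSum F fun k _ => (h k).pow 2) ?_
  filter_upwards [hM] with a ha using ha F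

/-- Subtracting a limit supported in `T` removes all the energy located in `T` from the remainder.
-/
theorem sum_sq_sub_le {d d' : ℤ → ℝ} {T : Finset ℤ} (hT : ∀ k ∉ T, d' k = 0)
    (h : ∀ k ∈ T, d k = d' k) (F : Finset ℤ) :
    ∑ k ∈ F, (d - d') k ^ 2 ≤ ∑ k ∈ F \ T, d k ^ 2 := by
  rw [← Finset.sum_subset (s₁ := F \ T) Finset.sdiff_subset]
  · refine (Finset.sum_congr rfl fun k hk => ?_).le
    rw [Pi.sub_apply, hT k (Finset.mem_sdiff.1 hk).2, sub_zero]
  · intro k hk hk'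
    have : k ∈ T := by
      by_contra hkT
      exact hk' (Finset.mem_sdiff.2 ⟨hk, hkT⟩)
    rw [Pi.sub_apply, h k this]
    simp

/-! ### Values of block products -/

/-- The modulus of the product of `cos (π e k)` over all integers `k`. -/
noncomputable def blockValue (e : ℤ → ℝ) : ℝ := |∏' k, Real.cos (Real.pi * e k)|

theorem summable_pi_mul {e : ℤ → ℝ} (he : Summable fun k => |e k|) :
    Summable fun k => |Real.pi * e k| := by
  simp_rw [abs_mul]
  exact he.mul_left _

theorem summable_cos_pi_mul {e : ℤ → ℝ} (he : Summable fun k => |e k|) :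
    Summable fun k => |Real.cos (Real.pi * e k) - 1| :=
  summable_abs_cos_sub_one (summable_pi_mul he)

theorem multipliable_cos_pi_mul {e : ℤ → ℝ} (he : Summable fun k => |e k|) :
    Multipliable fun k => Real.cos (Real.pi * e k) :=
  multipliable_of_summable_abs_sub_one (summable_cos_pi_mul he)

theorem blockValue_mem_Icc {e : ℤ → ℝ} (he : Summable fun k => |e k|) :
    blockValue e ∈ Icc (0 : ℝ) 1 :=
  ⟨abs_nonneg _, (abs_tprod_le_abs (multipliable_cos_pi_mul he)
    (fun _ => Real.abs_cos_le_one _) 0).trans (Real.abs_cos_le_one _)⟩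

theorem blockValue_zero : blockValue 0 = 1 := by
  simp [blockValue]

theorem blockValue_shift (e : ℤ → ℝ) (a : ℤ) :
    blockValue (fun k => e (k + a)) = blockValue e := by
  rw [blockValue, blockValue, ← (Equiv.addRight a).tprod_eq fun k => Real.cos (Real.pi * e k)]
  rfl

theorem abs_blockValue_sub_le {a b : ℤ → ℝ} (ha : Summable fun k => |a k|)
    (hb : Summable fun k => |b k|) :
    |blockValue a - blockValue b| ≤ Real.pi * ∑' k, |a k - b k| := by
  have hab : Summable fun k => |a k - b k| :=
    (ha.add hb).of_nonneg_of_le (fun _ => abs_nonneg _) fun k => abs_sub _ _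
  have hle : ∀ k, |Real.cos (Real.pi * a k) - Real.cos (Real.pi * b k)| ≤
      Real.pi * |a k - b k| := by
    intro k
    refine (Real.abs_cos_sub_cos_le _ _).trans_eq ?_
    rw [← mul_sub, abs_mul, abs_of_pos Real.pi_pos]
  have hs := (hab.mul_left Real.pi).of_nonneg_of_le (fun _ => abs_nonneg _) hle
  refine (abs_abs_sub_abs_le_abs_sub _ _).trans ?_
  refine (abs_tprod_sub_tprod_le (multipliable_cos_pi_mul ha) (multipliable_cos_pi_mul hb)
    (fun _ => Real.abs_cos_le_one _) (fun _ => Real.abs_cos_le_one _) hs).trans ?_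
  rw [← tsum_mul_left]
  exact hs.tsum_le_tsum hle (hab.mul_left _)

theorem abs_blockValue_add_sub_le {a b : ℤ → ℝ} (ha : Summable fun k => |a k|)
    (hb : Summable fun k => |b k|) :
    |blockValue (a + b) - blockValue a * blockValue b| ≤ Real.pi ^ 2 * ∑' k, |a k| * |b k| := by
  obtain ⟨R, hR⟩ : ∃ R, ∀ k, |b k| ≤ R := ⟨∑' k, |b k|, fun k =>
    hb.le_tsum k fun _ _ => abs_nonneg _⟩
  have hprod : Summable fun k => |a k| * |b k| :=
    (ha.mul_right R).of_nonneg_of_le (fun _ => by positivity)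
      fun k => mul_le_mul_of_nonneg_left (hR k) (abs_nonneg _)
  have hle : ∀ k, |Real.sin (Real.pi * a k) * Real.sin (Real.pi * b k)| ≤
      Real.pi ^ 2 * (|a k| * |b k|) := by
    intro k
    rw [abs_mul]
    refine (mul_le_mul (abs_sin_le_abs _) (abs_sin_le_abs _) (abs_nonneg _)
      (abs_nonneg _)).trans_eq ?_
    rw [abs_mul, abs_mul, abs_of_pos Real.pi_pos]
    ring
  have hs := (hprod.mul_left (Real.pi ^ 2)).of_nonneg_of_le (fun _ => abs_nonneg _) hle
  have hab : Summable fun k => |(a + b) k| :=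
    (ha.add hb).of_nonneg_of_le (fun _ => abs_nonneg _) fun k => abs_add_le _ _
  have h := abs_tprod_cos_add_sub_le (summable_cos_pi_mul ha) (summable_cos_pi_mul hb) (by
    simp_rw [← mul_add]
    exact summable_cos_pi_mul hab) hs
  rw [blockValue, blockValue, blockValue, ← abs_mul]
  refine (abs_abs_sub_abs_le_abs_sub _ _).trans ?_
  simp_rw [← mul_add] at h
  refine h.trans ?_
  rw [← tsum_mul_left]
  exact hs.tsum_le_tsum hle (hprod.mul_left _)

/-- Along an ultrafilter every quantity with values in a compact set converges, which avoids
successive extraction of subsequences. -/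
theorem exists_ultrafilter_of_mem_closure_image {α β : Type*} [TopologicalSpace β] {f : α → β}
    {A : Set α} {z : β} (hz : z ∈ closure (f '' A)) :
    ∃ u : Ultrafilter α, A ∈ u ∧ Tendsto f u (𝓝 z) := by
  obtain ⟨w, hw, hwz⟩ := mem_closure_iff_ultrafilter.1 hz
  refine ⟨Ultrafilter.ofComapInfPrincipal hw, Ultrafilter.ofComapInfPrincipal_mem hw, ?_⟩
  have h := Ultrafilter.ofComapInfPrincipal_eq_of_map hw
  rw [Tendsto, ← Ultrafilter.coe_map, h]
  exact hwz

/-- Splitting off the pointwise limit of summable sequences: the block value is asymptotically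
the product of the block values of the limit and of the remainder. -/
theorem tendsto_blockValue_sub_mul {l : Filter (ℤ → ℝ)} {a : ℤ → ℝ} {R : ℝ}
    (hl : l ≤ 𝓝 a) (ha : Summable fun k => |a k|)
    (hs : ∀ᶠ e in l, Summable fun k => |e k|) (hR : ∀ᶠ e in l, ∀ k, |e k - a k| ≤ R) :
    Tendsto (fun e => blockValue e - blockValue a * blockValue (e - a)) l (𝓝 0) := by
  have hpt : ∀ k, Tendsto (fun e : ℤ → ℝ => e k) l (𝓝 (a k)) := fun k =>
    ((continuous_apply k).tendsto a).mono_left hl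
  have h0 : Tendsto (fun e : ℤ → ℝ => ∑' k, |a k| * |e k - a k|) l (𝓝 0) := by
    rw [← tsum_zero (α := ℝ) (β := ℤ)]
    refine tendsto_tsum_of_dominated_convergence (ha.mul_right R) (fun k => ?_) ?_
    · simpa using (((hpt k).sub_const (a k)).abs).const_mul |a k|
    · filter_upwards [hR] with e he k
      rw [Real.norm_eq_abs, abs_mul, abs_abs, abs_abs]
      exact mul_le_mul_of_nonneg_left (he k) (abs_nonneg _)
  have h1 : Tendsto (fun e : ℤ → ℝ => Real.pi ^ 2 * ∑' k, |a k| * |e k - a k|) l (𝓝 0) := by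
    simpa using h0.const_mul (Real.pi ^ 2)
  refine squeeze_zero_norm' ?_ h1
  filter_upwards [hs] with e he
  have hea : Summable fun k => |(e - a) k| :=
    (he.add ha).of_nonneg_of_le (fun _ => abs_nonneg _) fun k => abs_sub _ _
  have := abs_blockValue_add_sub_le ha hea
  rwa [add_sub_cancel] at this

/-! ### Countably many limits of two-sided blocks -/

/-- Summable two-sided sequences with integer-valued image under the recurrence operator. -/
def blockSeqs (Q : Polynomial ℤ) : Set (ℤ → ℝ) :=
  {e | (Summable fun k => |e k|) ∧ IntValued (recOp Q e)}

/-- The members of `blockSeqs Q` for which the squares of the values of the recurrence operator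
add up to at most `M`. -/
def boundedBlockSeqs (Q : Polynomial ℤ) (M : ℕ) : Set (ℤ → ℝ) :=
  {e | e ∈ blockSeqs Q ∧ ∀ F : Finset ℤ, ∑ k ∈ F, recOp Q e k ^ 2 ≤ M}

/-- The multiplicative monoid generated by the block values. -/
noncomputable def blockMonoid (Q : Polynomial ℤ) : Submonoid ℝ :=
  Submonoid.closure (blockValue '' blockSeqs Q)

theorem exists_abs_le_of_summable {e : ℤ → ℝ} (he : Summable fun k => |e k|) :
    ∃ R, ∀ k, |e k| ≤ R :=
  ⟨∑' k, |e k|, fun k => he.le_tsum k fun _ _ => abs_nonneg _⟩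

theorem tendsto_recOp_cofinite (Q : Polynomial ℤ) {e : ℤ → ℝ} (he : Summable fun k => |e k|) :
    Tendsto (recOp Q e) cofinite (𝓝 0) := by
  have h : Tendsto (fun k => ∑ i ∈ Finset.range (Q.natDegree + 1), (Q.coeff i : ℝ) * e (k + i))
      cofinite (𝓝 (∑ i ∈ Finset.range (Q.natDegree + 1), (Q.coeff i : ℝ) * 0)) := by
    refine tendsto_finsetSum _ fun i _ => Tendsto.const_mul _ ?_
    exact he.of_abs.tendsto_cofinite_zero.comp (add_left_injective (i : ℤ)).tendsto_cofinite
  simp only [mul_zero, Finset.sum_const_zero] at h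
  exact h

section Green

variable {Q : Polynomial ℤ} {g : ℤ → ℝ}

/-- The image of a block tends to zero and is integer-valued, hence finitely supported; there are
countably many such images, and `g` recovers the block. -/
theorem countable_blockSeqs (hg : Summable fun k => |g k|)
    (hgreen : ∀ k, recOp Q g k = if k = 0 then 1 else 0) : (blockSeqs Q).Countable := by
  refine (Set.countable_range fun n : ℤ →₀ ℤ => seqConv g fun k => (n k : ℝ)).mono ?_
  rintro e ⟨he, hInt⟩
  obtain ⟨R, hR⟩ := exists_abs_le_of_summable he
  obtain ⟨n, hn⟩ := exists_finsupp_eq hInt (finite_support_of_intValued hInt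
    (by simpa using (tendsto_recOp_cofinite Q he).pow 2))
  refine ⟨n, ?_⟩
  beta_reduce
  rw [← hn]
  ext k
  exact seqConv_recOp hg hgreen hR k

theorem countable_blockMonoid (hg : Summable fun k => |g k|)
    (hgreen : ∀ k, recOp Q g k = if k = 0 then 1 else 0) :
    (blockMonoid Q : Set ℝ).Countable := by
  have h := (countable_blockSeqs hg hgreen).image blockValue
  have : Countable (blockValue '' blockSeqs Q) := h.to_subtype
  rw [blockMonoid, Submonoid.closure_eq_mrange, MonoidHom.coe_mrange]
  have : Countable (FreeMonoid (blockValue '' blockSeqs Q)) :=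
    inferInstanceAs (Countable (List (blockValue '' blockSeqs Q)))
  exact Set.countable_range _

theorem summable_of_recOp_finite_support (hg : Summable fun k => |g k|)
    (hgreen : ∀ k, recOp Q g k = if k = 0 then 1 else 0) {e : ℤ → ℝ} {R : ℝ}
    (he : ∀ k, |e k| ≤ R) (h : (Function.support (recOp Q e)).Finite) :
    Summable fun k => |e k| := by
  have h1 := (summable_seqConv hg (summable_abs_of_finite_support h)).1
  simpa only [seqConv_recOp hg hgreen he] using h1

theorem abs_le_of_mem_boundedBlockSeqs (hg : Summable fun k => |g k|)
    (hgreen : ∀ k, recOp Q g k = if k = 0 then 1 else 0) {M : ℕ} {e : ℤ → ℝ}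
    (he : e ∈ boundedBlockSeqs Q M) (k : ℤ) : |e k| ≤ (∑' j, |g j|) * M := by
  obtain ⟨R, hR⟩ := exists_abs_le_of_summable he.1.1
  rw [← seqConv_recOp hg hgreen hR k]
  exact abs_seqConv_le hg (abs_le_of_sum_sq_le he.1.2 he.2) k

theorem recOp_shift (e : ℤ → ℝ) (a k : ℤ) :
    recOp Q (fun k => e (k + a)) k = recOp Q e (k + a) := by
  simp only [recOp]
  refine Finset.sum_congr rfl fun i _ => ?_
  rw [add_right_comm]

theorem shift_mem_boundedBlockSeqs {M : ℕ} {e : ℤ → ℝ} (he : e ∈ boundedBlockSeqs Q M) (a : ℤ) :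
    (fun k => e (k + a)) ∈ boundedBlockSeqs Q M := by
  refine ⟨⟨he.1.1.comp_injective (i := fun k : ℤ => k + a) (add_left_injective a), fun k => ?_⟩,
    fun F => ?_⟩
  · rw [recOp_shift]
    exact he.1.2 _
  · have := he.2 (F.map (Equiv.addRight a).toEmbedding)
    rw [Finset.sum_map] at this
    simp_rw [recOp_shift]
    exact this

theorem eq_zero_of_recOp_eq_zero (hg : Summable fun k => |g k|)
    (hgreen : ∀ k, recOp Q g k = if k = 0 then 1 else 0) {e : ℤ → ℝ}
    (he : Summable fun k => |e k|) (h : ∀ k, recOp Q e k = 0) : e = 0 := by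
  obtain ⟨R, hR⟩ := exists_abs_le_of_summable he
  ext k
  rw [← seqConv_recOp hg hgreen hR k]
  simp [seqConv, h]

/-- Block values are translation invariant, so a nonzero block may be recentred to have a nonzero
integer at zero. A pointwise limit then cannot miss it. -/
theorem image_boundedBlockSeqs_subset (hg : Summable fun k => |g k|)
    (hgreen : ∀ k, recOp Q g k = if k = 0 then 1 else 0) (M : ℕ) :
    blockValue '' boundedBlockSeqs Q M ⊆
      {1} ∪ blockValue '' {e | e ∈ boundedBlockSeqs Q M ∧ recOp Q e 0 ≠ 0} := by
  rintro _ ⟨e, he, rfl⟩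
  by_cases h : ∀ k, recOp Q e k = 0
  · left
    rw [eq_zero_of_recOp_eq_zero hg hgreen he.1.1 h, blockValue_zero]
    rfl
  · right
    push Not at h
    obtain ⟨a, ha⟩ := h
    refine ⟨fun k => e (k + a), ⟨shift_mem_boundedBlockSeqs he a, ?_⟩, blockValue_shift e a⟩
    rwa [recOp_shift, zero_add]

/-- Induction on the energy `M`. After recentring, the pointwise limit `a` retains the nonzero
integer at zero, so the remainder `e - a` has energy smaller by at least one. Asymptotically the
value factors into that of `a` and that of the remainder. -/
theorem closure_image_boundedBlockSeqs_subset (hg : Summable fun k => |g k|)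
    (hgreen : ∀ k, recOp Q g k = if k = 0 then 1 else 0) (M : ℕ) :
    closure (blockValue '' boundedBlockSeqs Q M) ⊆ blockMonoid Q := by
  induction M with
  | zero =>
    have hsub : blockValue '' boundedBlockSeqs Q 0 ⊆ {1} := by
      intro x hx
      rcases image_boundedBlockSeqs_subset hg hgreen 0 hx with h | ⟨e, ⟨he, h0⟩, -⟩
      · exact h
      · have := he.2 {0}
        rw [Finset.sum_singleton] at this
        exact absurd (pow_eq_zero_iff two_ne_zero |>.1
          (le_antisymm (by simpa using this) (sq_nonneg _))) h0
    intro z hz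
    have := closure_mono hsub hz
    rw [closure_singleton, mem_singleton_iff] at this
    rw [this]
    exact one_mem _
  | succ M ih =>
    intro z hz
    have hz' := closure_mono (image_boundedBlockSeqs_subset hg hgreen (M + 1)) hz
    rw [closure_union, closure_singleton] at hz'
    rcases hz' with hz' | hz'
    · rw [mem_singleton_iff.1 hz']
      exact one_mem _
    obtain ⟨u, hu, huz⟩ := exists_ultrafilter_of_mem_closure_image hz'
    set R : ℝ := (∑' j, |g j|) * (M + 1 : ℕ) with hR
    have hmem : ∀ᶠ e in (u : Filter (ℤ → ℝ)), e ∈ boundedBlockSeqs Q (M + 1) ∧ recOp Q e 0 ≠ 0 :=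
      hu
    have hbd : ∀ᶠ e in (u : Filter (ℤ → ℝ)), ∀ k, |e k| ≤ R := by
      filter_upwards [hmem] with e he using abs_le_of_mem_boundedBlockSeqs hg hgreen he.1
    have hK : IsCompact (Set.univ.pi fun _ : ℤ => Icc (-R) R) :=
      isCompact_univ_pi fun _ => isCompact_Icc
    obtain ⟨a, haK, hua⟩ := hK.ultrafilter_le_nhds u (by
      rw [le_principal_iff]
      filter_upwards [hbd] with e he k _ using abs_le.1 (he k))
    have haR : ∀ k, |a k| ≤ R := fun k => abs_le.2 (haK k (mem_univ k))
    have hrec : ∀ k, Tendsto (fun e => recOp Q e k) u (𝓝 (recOp Q a k)) := fun k =>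
      ((continuous_recOp Q k).tendsto a).mono_left hua
    have hInt : ∀ᶠ e in (u : Filter (ℤ → ℝ)), IntValued (recOp Q e) := by
      filter_upwards [hmem] with e he using he.1.1.2
    have haint : IntValued (recOp Q a) := IntValued.tendsto hInt hrec
    have hasum : ∀ F : Finset ℤ, ∑ k ∈ F, recOp Q a k ^ 2 ≤ (M + 1 : ℕ) :=
      sum_sq_le_of_tendsto (by filter_upwards [hmem] with e he using he.1.2) hrec
    have hafin := finite_support_of_sum_sq_le haint hasum
    have has : Summable fun k => |a k| := summable_of_recOp_finite_support hg hgreen haR hafin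
    set T := hafin.toFinset with hT
    have hTeq : ∀ᶠ e in (u : Filter (ℤ → ℝ)), ∀ k ∈ T, recOp Q e k = recOp Q a k :=
      (Finset.eventually_all T).2 fun k _ => IntValued.eventually_eq hInt hrec k
    have hbM : ∀ᶠ e in (u : Filter (ℤ → ℝ)), e - a ∈ boundedBlockSeqs Q M := by
      filter_upwards [hmem, hTeq, IntValued.eventually_eq hInt hrec 0] with e he heT he0
      have hrs : recOp Q (e - a) = recOp Q e - recOp Q a := funext fun k => recOp_sub Q e a k
      refine ⟨⟨(he.1.1.1.add has).of_nonneg_of_le (fun _ => abs_nonneg _)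
        fun k => abs_sub _ _, ?_⟩, fun F => ?_⟩
      · rw [hrs]
        exact he.1.1.2.sub haint
      · rw [hrs]
        refine (sum_sq_sub_le (T := T) (fun k hk => ?_) heT F).trans ?_
        · simpa [hT] using hk
        · have h0T : (0 : ℤ) ∉ F \ T := by
            rw [Finset.mem_sdiff, not_and_not_right]
            intro _
            simpa [hT, ← he0] using he.2
          -- The index zero lies in `T`, so its contribution, at least one, comes on top of the
          -- energy outside `T`.
          have h1 := he.1.2 (insert 0 (F \ T))
          rw [Finset.sum_insert h0T] at h1
          obtain ⟨n, hn⟩ := he.1.1.2 0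
          have h2 : (1 : ℝ) ≤ recOp Q e 0 ^ 2 := by
            have hn0 : n ≠ 0 := by
              rintro rfl
              exact he.2 (by simpa using hn)
            rw [hn]
            exact one_le_intCast_sq hn0
          push_cast at h1
          linarith
    have hes : ∀ᶠ e in (u : Filter (ℤ → ℝ)), Summable fun k => |e k| := by
      filter_upwards [hmem] with e he using he.1.1.1
    have hlim := tendsto_blockValue_sub_mul (R := R + R) hua has hes (by
      filter_upwards [hbd] with e he k using (abs_sub _ _).trans (add_le_add (he k) (haR k)))
    obtain ⟨y, -, hy⟩ := (isCompact_Icc (a := (0 : ℝ)) (b := 1)).ultrafilter_le_nhds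
      (u.map fun e => blockValue (e - a)) (by
        rw [le_principal_iff, Ultrafilter.coe_map, mem_map]
        filter_upwards [hbM] with e he using blockValue_mem_Icc he.1.1)
    have hy' : Tendsto (fun e => blockValue (e - a)) u (𝓝 y) := hy
    have hyM : y ∈ blockMonoid Q := ih (mem_closure_of_tendsto hy' (by
      filter_upwards [hbM] with e he using ⟨_, he, rfl⟩))
    have hz0 : z - blockValue a * y = 0 :=
      tendsto_nhds_unique (huz.sub (hy'.const_mul (blockValue a))) hlim
    rw [sub_eq_zero.1 hz0]
    exact mul_mem (Submonoid.subset_closure ⟨a, ⟨has, haint⟩, rfl⟩) hyM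

end Green

/-! ### Countably many limits along a half-line -/

/-- The restriction of a two-sided sequence to the nonnegative integers, extended by zero. -/
def halfPart (d : ℤ → ℝ) (k : ℤ) : ℝ := if 0 ≤ k then d k else 0

theorem halfPart_sub (d d' : ℤ → ℝ) : halfPart (d - d') = halfPart d - halfPart d' := by
  ext k
  simp only [halfPart, Pi.sub_apply]
  split_ifs <;> simp

theorem recOp_eq_zero_of_lt {Q : Polynomial ℤ} {e : ℤ → ℝ} (he : ∀ k < 0, e k = 0) {k : ℤ}
    (hk : k < -(Q.natDegree : ℤ)) : recOp Q e k = 0 := by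
  refine Finset.sum_eq_zero fun i hi => ?_
  rw [Finset.mem_range] at hi
  rw [he _ (by omega), mul_zero]

theorem finite_support_recOp {Q : Polynomial ℤ} {e : ℤ → ℝ} (he : ∀ k < 0, e k = 0)
    (h : (Function.support (halfPart (recOp Q e))).Finite) :
    (Function.support (recOp Q e)).Finite := by
  refine (h.union (Set.finite_Ico (-(Q.natDegree : ℤ)) 0)).subset fun k hk => ?_
  rcases le_or_gt 0 k with hk0 | hk0
  · left
    rwa [Function.mem_support, halfPart, if_pos hk0]
  · right
    refine ⟨?_, hk0⟩
    by_contra hlt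
    exact hk (recOp_eq_zero_of_lt he (not_le.1 hlt))

/-- Only on the window from `-deg Q` to `-1` does the operator see both sides of the cut at zero.
Integrality is not available there, so this boundary part is estimated separately. -/
theorem tsum_abs_sub_halfPart {Q : Polynomial ℤ} {e : ℤ → ℝ} (he : ∀ k < 0, e k = 0) :
    (Summable fun k => |(recOp Q e - halfPart (recOp Q e)) k|) ∧
    ∑' k, |(recOp Q e - halfPart (recOp Q e)) k| =
      ∑ k ∈ Finset.Ico (-(Q.natDegree : ℤ)) 0, |recOp Q e k| := by
  have h0 : ∀ k ∉ Finset.Ico (-(Q.natDegree : ℤ)) 0,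
      |(recOp Q e - halfPart (recOp Q e)) k| = 0 := by
    intro k hk
    rw [Pi.sub_apply, abs_eq_zero, halfPart]
    split_ifs with hk0
    · exact sub_self _
    · rw [sub_zero]
      refine recOp_eq_zero_of_lt he ?_
      by_contra hlt
      exact hk (Finset.mem_Ico.2 ⟨not_lt.1 hlt, not_le.1 hk0⟩)
  refine ⟨summable_of_ne_finset_zero h0, ?_⟩
  rw [tsum_eq_sum h0]
  refine Finset.sum_congr rfl fun k hk => ?_
  rw [Pi.sub_apply, halfPart, if_neg (by rw [Finset.mem_Ico] at hk; omega), sub_zero]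

theorem seqConv_sub {g d d' : ℤ → ℝ} (hg : Summable fun k => |g k|) {R R' : ℝ}
    (hd : ∀ k, |d k| ≤ R) (hd' : ∀ k, |d' k| ≤ R') (k : ℤ) :
    seqConv g (d - d') k = seqConv g d k - seqConv g d' k := by
  rw [seqConv, seqConv, seqConv, ← Summable.tsum_sub (summable_seqConv_term hg hd k).of_abs
    (summable_seqConv_term hg hd' k).of_abs]
  refine tsum_congr fun j => ?_
  rw [Pi.sub_apply, mul_sub]

/-- Bounded sequences on the nonnegative integers whose image under the recurrence operator `Q` is
integer-valued and finitely supported there, and which satisfy an integrality condition at `0`. -/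
def halfSeqs (Q h : Polynomial ℤ) : Set (ℤ → ℝ) :=
  {e | (∀ k < 0, e k = 0) ∧ (∃ R, ∀ k, |e k| ≤ R) ∧ IntValued (halfPart (recOp Q e)) ∧
    (Function.support (halfPart (recOp Q e))).Finite ∧ ∃ n : ℤ, recOp h e 0 = n}

/-- Summable sequences on the nonnegative integers, bounded by `1 / 2`, with quantitative
integrality conditions. -/
def boundedHalfSeqs (Q h : Polynomial ℤ) (M : ℕ) : Set (ℤ → ℝ) :=
  {e | (∀ k < 0, e k = 0) ∧ (Summable fun k => |e k|) ∧ (∀ k, |e k| ≤ 1 / 2) ∧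
    IntValued (halfPart (recOp Q e)) ∧
    (∀ F : Finset ℤ, ∑ k ∈ F, halfPart (recOp Q e) k ^ 2 ≤ M) ∧ ∃ n : ℤ, recOp h e 0 = n}

/-- Equal images under `Q` on the half-line leave only a difference `c θ⁻ᵏ`; equality of the values
for `h` at zero gives `c h(θ⁻¹) = 0`, so `c = 0`. The remaining data are a finitely supported
integer sequence and one integer. -/
theorem countable_halfSeqs {θ : ℝ} {Q h : Polynomial ℤ} {s : Multiset ℂ} (hθ : 1 < θ)
    (hQ : Q.map (Int.castRingHom ℂ) = (1 - Polynomial.C (θ : ℂ) * Polynomial.X) *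
        (s.map fun α => 1 - Polynomial.C α * Polynomial.X).prod) (hs : ∀ α ∈ s, ‖α‖ < 1)
    (hh : Polynomial.aeval θ⁻¹ h ≠ 0) : (halfSeqs Q h).Countable := by
  refine Set.countable_of_injective_of_countable_image
    (f := fun e => (halfPart (recOp Q e), recOp h e 0)) ?_ ?_
  · rintro e ⟨he0, ⟨R, hR⟩, -⟩ e' ⟨he0', ⟨R', hR'⟩, -⟩ heq
    obtain ⟨h1, h2⟩ := Prod.mk.inj heq
    have hb : ∀ k, |(e - e') k| ≤ R + R' := fun k =>
      (abs_sub _ _).trans (add_le_add (hR k) (hR' k))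
    have hrec : ∀ k, 0 ≤ k → recOp Q (e - e') k = 0 := by
      intro k hk
      have := congrFun h1 k
      rw [halfPart, halfPart, if_pos hk, if_pos hk] at this
      rw [recOp_sub, this, sub_self]
    have hgeo := eq_mul_inv_pow_of_recOp_eq_zero hθ hQ hs hb hrec
    have h0 : (e - e') 0 = 0 := by
      have h3 : recOp h (e - e') 0 = 0 := by rw [recOp_sub, h2, sub_self]
      have h4 : recOp h (e - e') 0 = (e - e') 0 * Polynomial.aeval θ⁻¹ h := by
        rw [recOp, Polynomial.aeval_eq_sum_range, Finset.mul_sum]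
        refine Finset.sum_congr rfl fun i _ => ?_
        rw [zero_add, hgeo i, zsmul_eq_mul]
        ring
      rw [h4] at h3
      exact (mul_eq_zero.1 h3).resolve_right hh
    ext k
    rw [← sub_eq_zero, ← Pi.sub_apply]
    rcases le_or_gt 0 k with hk | hk
    · obtain ⟨n, rfl⟩ := Int.eq_ofNat_of_zero_le hk
      rw [hgeo n, h0, zero_mul]
    · rw [Pi.sub_apply, he0 k hk, he0' k hk, sub_zero]
  · refine (Set.countable_range fun p : (ℤ →₀ ℤ) × ℤ =>
      ((fun k => (p.1 k : ℝ), (p.2 : ℝ)) : (ℤ → ℝ) × ℝ)).mono ?_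
    rintro _ ⟨e, ⟨-, -, hInt, hfin, m, hm⟩, rfl⟩
    obtain ⟨n, hn⟩ := exists_finsupp_eq hInt hfin
    exact ⟨(n, m), Prod.ext hn.symm hm.symm⟩

section Green

variable {Q : Polynomial ℤ} {g : ℤ → ℝ}

/-- A sequence on the half-line differs from a two-sided block by little, if the initial values of
the recurrence operator are small. -/
theorem seqConv_halfPart_mem_boundedBlockSeqs (hg : Summable fun k => |g k|)
    (hgreen : ∀ k, recOp Q g k = if k = 0 then 1 else 0) {M : ℕ} {b : ℤ → ℝ}
    (hb0 : ∀ k < 0, b k = 0) (hb : Summable fun k => |b k|)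
    (hInt : IntValued (halfPart (recOp Q b)))
    (hM : ∀ F : Finset ℤ, ∑ k ∈ F, halfPart (recOp Q b) k ^ 2 ≤ M) :
    seqConv g (halfPart (recOp Q b)) ∈ boundedBlockSeqs Q M ∧
      |blockValue b - blockValue (seqConv g (halfPart (recOp Q b)))| ≤
        Real.pi * ((∑' k, |g k|) *
          ∑ k ∈ Finset.Ico (-(Q.natDegree : ℤ)) 0, |recOp Q b k|) := by
  have hfin := finite_support_of_sum_sq_le hInt hM
  have hsum := summable_abs_of_finite_support hfin
  have hsum' := summable_abs_of_finite_support (finite_support_recOp hb0 hfin)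
  obtain ⟨R, hR⟩ := exists_abs_le_of_summable hsum
  obtain ⟨R', hR'⟩ := exists_abs_le_of_summable hsum'
  obtain ⟨R'', hR''⟩ := exists_abs_le_of_summable hb
  have hrec : recOp Q (seqConv g (halfPart (recOp Q b))) = halfPart (recOp Q b) :=
    funext fun k => recOp_seqConv hg hgreen hR k
  have hc := (summable_seqConv hg hsum).1
  refine ⟨⟨⟨hc, by rwa [hrec]⟩, by rwa [hrec]⟩, ?_⟩
  refine (abs_blockValue_sub_le hb hc).trans (mul_le_mul_of_nonneg_left ?_ Real.pi_pos.le)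
  have he : ∀ k, b k - seqConv g (halfPart (recOp Q b)) k =
      seqConv g (recOp Q b - halfPart (recOp Q b)) k := by
    intro k
    rw [seqConv_sub hg hR' hR, seqConv_recOp hg hgreen hR'']
  obtain ⟨h1, h2⟩ := tsum_abs_sub_halfPart (Q := Q) hb0
  simp_rw [he]
  rw [← h2]
  exact (summable_seqConv hg h1).2

/-- The pointwise limit `a` is the block that stays near the origin. The remainder tends to zero on
the boundary window, so it can be replaced by a two-sided block of bounded energy, whose limiting
values are already known. -/
theorem closure_image_boundedHalfSeqs_subset (hg : Summable fun k => |g k|)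
    (hgreen : ∀ k, recOp Q g k = if k = 0 then 1 else 0) (h : Polynomial ℤ) (M : ℕ) :
    closure (blockValue '' boundedHalfSeqs Q h M) ⊆
      Set.image2 (fun a y => blockValue a * y) (halfSeqs Q h) (blockMonoid Q) := by
  intro z hz
  obtain ⟨u, hu, huz⟩ := exists_ultrafilter_of_mem_closure_image hz
  have hmem : ∀ᶠ e in (u : Filter (ℤ → ℝ)), e ∈ boundedHalfSeqs Q h M := hu
  have hK : IsCompact (Set.univ.pi fun _ : ℤ => Icc (-(1 / 2) : ℝ) (1 / 2)) :=
    isCompact_univ_pi fun _ => isCompact_Icc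
  obtain ⟨a, haK, hua⟩ := hK.ultrafilter_le_nhds u (by
    rw [le_principal_iff]
    filter_upwards [hmem] with e he k _ using abs_le.1 (he.2.2.1 k))
  have haR : ∀ k, |a k| ≤ 1 / 2 := fun k => abs_le.2 (haK k (mem_univ k))
  have hpt : ∀ k, Tendsto (fun e : ℤ → ℝ => e k) u (𝓝 (a k)) := fun k =>
    ((continuous_apply k).tendsto a).mono_left hua
  have hrec : ∀ (P : Polynomial ℤ) (k : ℤ),
      Tendsto (fun e => recOp P e k) u (𝓝 (recOp P a k)) := fun P k =>
    ((continuous_recOp P k).tendsto a).mono_left hua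
  have hrec' : ∀ k, Tendsto (fun e => halfPart (recOp Q e) k) u (𝓝 (halfPart (recOp Q a) k)) := by
    intro k
    unfold halfPart
    split_ifs
    · exact hrec Q k
    · exact tendsto_const_nhds
  have ha0 : ∀ k < 0, a k = 0 := by
    intro k hk
    refine tendsto_nhds_unique (hpt k) (tendsto_const_nhds.congr' ?_)
    filter_upwards [hmem] with e he using (he.1 k hk).symm
  have hInt : ∀ᶠ e in (u : Filter (ℤ → ℝ)), IntValued (halfPart (recOp Q e)) := by
    filter_upwards [hmem] with e he using he.2.2.2.1
  have haint : IntValued (halfPart (recOp Q a)) := IntValued.tendsto hInt hrec'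
  have hasum : ∀ F : Finset ℤ, ∑ k ∈ F, halfPart (recOp Q a) k ^ 2 ≤ M :=
    sum_sq_le_of_tendsto (by filter_upwards [hmem] with e he using he.2.2.2.2.1) hrec'
  have hafin := finite_support_of_sum_sq_le haint hasum
  have has : Summable fun k => |a k| :=
    summable_of_recOp_finite_support hg hgreen haR (finite_support_recOp ha0 hafin)
  have hah : ∃ n : ℤ, recOp h a 0 = n := by
    have : recOp h a 0 ∈ Set.range ((↑) : ℤ → ℝ) := by
      refine Int.isClosedEmbedding_coe_real.isClosed_range.mem_of_tendsto (hrec h 0) ?_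
      filter_upwards [hmem] with e he
      obtain ⟨n, hn⟩ := he.2.2.2.2.2
      exact ⟨n, hn.symm⟩
    obtain ⟨n, hn⟩ := this
    exact ⟨n, hn.symm⟩
  set T := hafin.toFinset with hT
  have hTeq : ∀ᶠ e in (u : Filter (ℤ → ℝ)),
      ∀ k ∈ T, halfPart (recOp Q e) k = halfPart (recOp Q a) k :=
    (Finset.eventually_all T).2 fun k _ => IntValued.eventually_eq hInt hrec' k
  have hb : ∀ᶠ e in (u : Filter (ℤ → ℝ)), (∀ k < 0, (e - a) k = 0) ∧
      (Summable fun k => |(e - a) k|) ∧ IntValued (halfPart (recOp Q (e - a))) ∧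
      ∀ F : Finset ℤ, ∑ k ∈ F, halfPart (recOp Q (e - a)) k ^ 2 ≤ M := by
    filter_upwards [hmem, hTeq] with e he heT
    have hrs : halfPart (recOp Q (e - a)) = halfPart (recOp Q e) - halfPart (recOp Q a) := by
      rw [← halfPart_sub]
      congr 1
      exact funext fun k => recOp_sub Q e a k
    refine ⟨fun k hk => by rw [Pi.sub_apply, he.1 k hk, ha0 k hk, sub_zero],
      (he.2.1.add has).of_nonneg_of_le (fun _ => abs_nonneg _) fun k => abs_sub _ _, ?_,
      fun F => ?_⟩
    · rw [hrs]
      exact he.2.2.2.1.sub haint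
    · rw [hrs]
      refine (sum_sq_sub_le (T := T) (fun k hk => ?_) heT F).trans (he.2.2.2.2.1 _)
      simpa [hT] using hk
  have hlim := tendsto_blockValue_sub_mul (R := 1 / 2 + 1 / 2) hua has
    (by filter_upwards [hmem] with e he using he.2.1) (by
      filter_upwards [hmem] with e he k
      exact (abs_sub _ _).trans (add_le_add (he.2.2.1 k) (haR k)))
  -- Discarding the non-integral boundary values before applying the Green function produces a
  -- genuine two-sided block.
  set B : (ℤ → ℝ) → ℤ → ℝ := fun e => seqConv g (halfPart (recOp Q (e - a))) with hB
  have hBlim : Tendsto (fun e => blockValue (e - a) - blockValue (B e)) u (𝓝 0) := by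
    have h0 : Tendsto (fun e => Real.pi * ((∑' k, |g k|) *
        ∑ k ∈ Finset.Ico (-(Q.natDegree : ℤ)) 0, |recOp Q (e - a) k|)) u
        (𝓝 (Real.pi * ((∑' k, |g k|) * ∑ k ∈ Finset.Ico (-(Q.natDegree : ℤ)) 0, 0))) := by
      refine ((tendsto_finsetSum _ fun k _ => ?_).const_mul _).const_mul _
      simp_rw [recOp_sub]
      simpa using ((hrec Q k).sub_const (recOp Q a k)).abs
    rw [Finset.sum_const_zero, mul_zero, mul_zero] at h0
    refine squeeze_zero_norm' ?_ h0
    filter_upwards [hb] with e he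
    exact (seqConv_halfPart_mem_boundedBlockSeqs hg hgreen he.1 he.2.1 he.2.2.1 he.2.2.2).2
  have hBM : ∀ᶠ e in (u : Filter (ℤ → ℝ)), B e ∈ boundedBlockSeqs Q M := by
    filter_upwards [hb] with e he
    exact (seqConv_halfPart_mem_boundedBlockSeqs hg hgreen he.1 he.2.1 he.2.2.1 he.2.2.2).1
  obtain ⟨y, -, hy⟩ := (isCompact_Icc (a := (0 : ℝ)) (b := 1)).ultrafilter_le_nhds
    (u.map fun e => blockValue (B e)) (by
      rw [le_principal_iff, Ultrafilter.coe_map, mem_map]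
      filter_upwards [hBM] with e he using blockValue_mem_Icc he.1.1)
  have hy' : Tendsto (fun e => blockValue (B e)) u (𝓝 y) := hy
  have hyM : y ∈ blockMonoid Q := closure_image_boundedBlockSeqs_subset hg hgreen M
    (mem_closure_of_tendsto hy' (by filter_upwards [hBM] with e he using ⟨_, he, rfl⟩))
  have hby : Tendsto (fun e => blockValue (e - a)) u (𝓝 y) := by
    simpa using hBlim.add hy'
  have hz0 : z - blockValue a * y = 0 :=
    tendsto_nhds_unique (huz.sub (hby.const_mul (blockValue a))) hlim
  exact ⟨a, ⟨ha0, ⟨_, haR⟩, haint, hafin, hah⟩, y, hyM, (sub_eq_zero.1 hz0).symm⟩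

end Green

/-! ### Countability of the closure of the set of values -/

/-- The signed distances of `2 t θ⁻ᵏ`, `k ≥ 0`, to the nearest integers. -/
noncomputable def distSeq (θ t : ℝ) (k : ℤ) : ℝ :=
  if 0 ≤ k then 2 * t * θ⁻¹ ^ k.toNat - round (2 * t * θ⁻¹ ^ k.toNat) else 0

theorem distSeq_natCast (θ t : ℝ) (n : ℕ) :
    distSeq θ t n = 2 * t * θ⁻¹ ^ n - round (2 * t * θ⁻¹ ^ n) := by
  simp [distSeq]

theorem distSeq_of_neg (θ t : ℝ) {k : ℤ} (hk : k < 0) : distSeq θ t k = 0 := by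
  rw [distSeq, if_neg (by omega)]

theorem abs_distSeq_le (θ t : ℝ) (k : ℤ) : |distSeq θ t k| ≤ 1 / 2 := by
  unfold distSeq
  split_ifs
  · exact abs_sub_round _
  · norm_num

theorem summable_distSeq {θ : ℝ} (hθ : 1 < θ) (t : ℝ) : Summable fun k => |distSeq θ t k| := by
  refine Summable.of_nat_of_neg_add_one ?_ ?_
  · have h : Summable fun n : ℕ => |2 * t * θ⁻¹ ^ n| :=
      ((summable_geometric_of_lt_one (by positivity) (inv_lt_one_of_one_lt₀ hθ)).mul_left _).abs
    refine h.of_nonneg_of_le (fun _ => abs_nonneg _) fun n => ?_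
    rw [distSeq_natCast]
    simpa using round_le (2 * t * θ⁻¹ ^ n) 0
  · refine summable_zero.congr fun n => ?_
    rw [distSeq_of_neg θ t (by omega), abs_zero]

/-- Subtracting the nearest integer to `2 t θ⁻ᵏ` changes the angle by a multiple of `π`; only a sign
is lost, which explains the factor `2` and the absolute values. -/
theorem blockValue_distSeq {θ : ℝ} (hθ : 1 < θ) (t : ℝ) :
    blockValue (distSeq θ t) = |cosProduct θ t| := by
  have h1 : Multipliable fun n : ℕ => Real.cos (Real.pi * distSeq θ t n) :=
    multipliable_of_summable_abs_sub_one
      ((summable_cos_pi_mul (summable_distSeq hθ t)).comp_injective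
        (i := fun n : ℕ => (n : ℤ)) Nat.cast_injective)
  have h2 : ∀ n : ℕ, Real.cos (Real.pi * distSeq θ t (-((n : ℤ) + 1))) = 1 := by
    intro n
    rw [distSeq_of_neg θ t (by omega), mul_zero, Real.cos_zero]
  rw [blockValue, tprod_of_nat_of_neg_add_one (f := fun k => Real.cos (Real.pi * distSeq θ t k)) h1
    (by simp_rw [h2]; exact multipliable_one)]
  simp_rw [h2]
  rw [tprod_one, mul_one, cosProduct, ← Real.norm_eq_abs, ← Real.norm_eq_abs, h1.norm_tprod,
    (multipliable_cosProduct hθ t).norm_tprod]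
  refine tprod_congr fun n => ?_
  rw [distSeq_natCast, mul_sub, mul_comm Real.pi (round _ : ℝ), Real.cos_sub_int_mul_pi, norm_mul]
  have : ‖((-1 : ℝ) ^ round (2 * t * θ⁻¹ ^ n))‖ = 1 := by simp
  rw [this, one_mul, inv_pow]
  congr 2
  ring

theorem recOp_distSeq_int {θ : ℝ} (P : Polynomial ℤ) (t : ℝ) (n : ℕ) :
    ∃ m : ℤ, recOp P (distSeq θ t) n = 2 * t * θ⁻¹ ^ n * Polynomial.aeval θ⁻¹ P - m := by
  refine ⟨∑ i ∈ Finset.range (P.natDegree + 1), P.coeff i * round (2 * t * θ⁻¹ ^ (n + i)), ?_⟩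
  rw [recOp, Polynomial.aeval_eq_sum_range, Finset.mul_sum]
  push_cast
  rw [← Finset.sum_sub_distrib]
  refine Finset.sum_congr rfl fun i _ => ?_
  rw [← Nat.cast_add, distSeq_natCast, zsmul_eq_mul, pow_add]
  ring

theorem intValued_halfPart_recOp_distSeq {θ : ℝ} {Q : Polynomial ℤ}
    (hQ : Polynomial.aeval θ⁻¹ Q = 0) (t : ℝ) :
    IntValued (halfPart (recOp Q (distSeq θ t))) := by
  intro k
  unfold halfPart
  split_ifs with hk
  · obtain ⟨n, rfl⟩ := Int.eq_ofNat_of_zero_le hk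
    obtain ⟨m, hm⟩ := recOp_distSeq_int (θ := θ) Q t n
    exact ⟨-m, by rw [hm, hQ]; push_cast; ring⟩
  · exact ⟨0, by simp⟩

theorem abs_tprod_le_abs_prod {ι : Type*} {f : ι → ℝ} (hfm : Multipliable f)
    (hf : ∀ i, |f i| ≤ 1) (F : Finset ι) : |∏' i, f i| ≤ ∏ i ∈ F, |f i| := by
  classical
  refine le_of_tendsto (Tendsto.abs hfm.hasProd) ?_
  change ∀ᶠ s : Finset ι in atTop, _
  filter_upwards [eventually_ge_atTop F] with s hs
  rw [Finset.abs_prod, ← Finset.prod_sdiff hs]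
  exact mul_le_of_le_one_left (Finset.prod_nonneg fun _ _ => abs_nonneg _)
    (Finset.prod_le_one (fun _ _ => abs_nonneg _) fun i _ => hf i)

/-- On this range `cos y ≤ 1 - (2 / π²) y²`. The Gaussian form converts a lower bound on a product
into an upper bound on a sum of squares. -/
theorem abs_cos_pi_mul_le {x : ℝ} (hx : |x| ≤ 1 / 2) :
    |Real.cos (Real.pi * x)| ≤ Real.exp (-(2 * x ^ 2)) := by
  have hpi := Real.pi_pos
  have habs : |Real.pi * x| ≤ Real.pi / 2 := by
    rw [abs_mul, abs_of_pos hpi]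
    nlinarith
  have hnn : 0 ≤ Real.cos (Real.pi * x) := Real.cos_nonneg_of_mem_Icc (abs_le.1 habs |> fun h =>
    ⟨by linarith [h.1], h.2⟩)
  have h1 := Real.cos_le_one_sub_mul_cos_sq (x := Real.pi * x) (by linarith)
  have h2 : 2 / Real.pi ^ 2 * (Real.pi * x) ^ 2 = 2 * x ^ 2 := by
    field_simp
  rw [abs_of_nonneg hnn]
  linarith [Real.add_one_le_exp (-(2 * x ^ 2))]

theorem sum_sq_le_of_le_blockValue {e : ℤ → ℝ} (he : Summable fun k => |e k|)
    (hhalf : ∀ k, |e k| ≤ 1 / 2) {δ : ℝ} (hδ : 0 < δ) (h : δ ≤ blockValue e) (F : Finset ℤ) :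
    ∑ k ∈ F, e k ^ 2 ≤ -Real.log δ / 2 := by
  have h1 : δ ≤ Real.exp (-(2 * ∑ k ∈ F, e k ^ 2)) := by
    refine h.trans ((abs_tprod_le_abs_prod (multipliable_cos_pi_mul he)
      (fun _ => Real.abs_cos_le_one _) F).trans ?_)
    rw [Finset.mul_sum, ← Finset.sum_neg_distrib, Real.exp_sum]
    exact Finset.prod_le_prod (fun _ _ => abs_nonneg _) fun k _ => abs_cos_pi_mul_le (hhalf k)
  have h2 := Real.log_le_log hδ h1
  rw [Real.log_exp] at h2
  linarith

theorem sum_sq_recOp_le (Q : Polynomial ℤ) {e : ℤ → ℝ} {C : ℝ}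
    (h : ∀ F : Finset ℤ, ∑ k ∈ F, e k ^ 2 ≤ C) (F : Finset ℤ) :
    ∑ k ∈ F, recOp Q e k ^ 2 ≤
      (∑ i ∈ Finset.range (Q.natDegree + 1), (Q.coeff i : ℝ) ^ 2) * ((Q.natDegree + 1) * C) := by
  set A := ∑ i ∈ Finset.range (Q.natDegree + 1), (Q.coeff i : ℝ) ^ 2 with hA
  have hA0 : 0 ≤ A := Finset.sum_nonneg fun _ _ => sq_nonneg _
  have h1 : ∀ k, recOp Q e k ^ 2 ≤ A * ∑ i ∈ Finset.range (Q.natDegree + 1), e (k + i) ^ 2 :=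
    fun k => Finset.sum_mul_sq_le_sq_mul_sq _ _ _
  refine (Finset.sum_le_sum fun k _ => h1 k).trans ?_
  rw [← Finset.mul_sum, Finset.sum_comm]
  refine mul_le_mul_of_nonneg_left ?_ hA0
  have h2 : ∀ i ∈ Finset.range (Q.natDegree + 1), ∑ k ∈ F, e (k + i) ^ 2 ≤ C := by
    intro i _
    have := h (F.map (Equiv.addRight (i : ℤ)).toEmbedding)
    rw [Finset.sum_map] at this
    exact this
  refine (Finset.sum_le_card_nsmul _ _ _ h2).trans_eq ?_
  simp

/-- The energy bound `M` depends on `δ` and `Q` but not on `t`, which is what the compactness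
argument needs. -/
theorem distSeq_mem_boundedHalfSeqs {θ : ℝ} (hθ : 1 < θ) {Q h : Polynomial ℤ}
    (hQ : Polynomial.aeval θ⁻¹ Q = 0) {δ : ℝ} (hδ : 0 < δ) :
    ∃ M : ℕ, ∀ t, δ ≤ |cosProduct θ t| → (∃ m : ℤ, 2 * t * Polynomial.aeval θ⁻¹ h = m) →
      distSeq θ t ∈ boundedHalfSeqs Q h M := by
  obtain ⟨M, hM⟩ := exists_nat_ge ((∑ i ∈ Finset.range (Q.natDegree + 1), (Q.coeff i : ℝ) ^ 2) *
    ((Q.natDegree + 1) * (-Real.log δ / 2)))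
  refine ⟨M, fun t ht ⟨m, hm⟩ => ⟨fun k hk => distSeq_of_neg θ t hk, summable_distSeq hθ t,
    abs_distSeq_le θ t, intValued_halfPart_recOp_distSeq hQ t, fun F => ?_, ?_⟩⟩
  · rw [← blockValue_distSeq hθ] at ht
    refine le_trans (Finset.sum_le_sum fun k _ => ?_) ((sum_sq_recOp_le Q
      (sum_sq_le_of_le_blockValue (summable_distSeq hθ t) (abs_distSeq_le θ t) hδ ht) F).trans hM)
    unfold halfPart
    split_ifs
    · exact le_rfl
    · simpa using sq_nonneg _
  · obtain ⟨n, hn⟩ := recOp_distSeq_int (θ := θ) h t 0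
    refine ⟨m - n, ?_⟩
    rw [← Nat.cast_zero, hn, pow_zero, mul_one, hm]
    push_cast
    ring

theorem IsPisot.countable_closure_range {θ r : ℝ} (hθ : IsPisot θ) (hr : r ≠ 0)
    (hrmem : r ∈ IntermediateField.adjoin ℚ ({θ} : Set ℝ)) :
    (closure (Set.range fun n : ℤ => cosProduct θ (r * n))).Countable := by
  obtain ⟨Q, s, hQ, hs⟩ := hθ.exists_recurrence
  obtain ⟨g, hg, hgreen⟩ := exists_green hθ.1 hQ hs
  have hQ0 : Polynomial.aeval θ⁻¹ Q = 0 := by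
    rw [Polynomial.aeval_eq_sum_range, ← sum_coeff_mul_inv_pow_eq_zero hθ.1 hQ]
    exact Finset.sum_congr rfl fun i _ => zsmul_eq_mul _ _
  -- With `h(θ⁻¹) = D r⁻¹`, the point `t = r n` satisfies `2 t h(θ⁻¹) = 2 D n`, an integer. This is
  -- where `r ∈ ℚ(θ)` enters.
  obtain ⟨D, hD, h, hh⟩ := exists_natCast_mul_eq_aeval hθ.isIntegral_rat.inv.isAlgebraic
    (inv_mem_adjoin_inv hrmem)
  have hD' : (D : ℝ) ≠ 0 := by positivity
  have hh0 : Polynomial.aeval θ⁻¹ h ≠ 0 := by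
    rw [← hh]
    exact mul_ne_zero hD' (inv_ne_zero hr)
  set S : Set ℝ := insert 0 (Set.image2 (fun a y => blockValue a * y) (halfSeqs Q h)
    (blockMonoid Q)) with hS
  have hScount : S.Countable :=
    ((countable_halfSeqs hθ.1 hQ hs hh0).image2 (countable_blockMonoid hg hgreen) _).insert 0
  have hsub : closure (Set.range fun n : ℤ => cosProduct θ (r * n)) ⊆ S ∪ Neg.neg '' S := by
    intro z hz
    suffices |z| ∈ S by
      rcases abs_choice z with h | h
      · exact Or.inl (h ▸ this)
      · exact Or.inr ⟨|z|, this, by rw [h, neg_neg]⟩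
    by_cases hz0 : z = 0
    · exact Or.inl (by simp [hz0])
    right
    -- Values close to a nonzero `z` have modulus at least `|z| / 2`, giving one energy bound for
    -- all of them.
    have hδ : 0 < |z| / 2 := by positivity
    obtain ⟨M, hM⟩ := distSeq_mem_boundedHalfSeqs hθ.1 (h := h) hQ0 hδ
    refine closure_image_boundedHalfSeqs_subset hg hgreen h M ?_
    rw [Metric.mem_closure_iff] at hz ⊢
    intro ε hε
    obtain ⟨_, ⟨n, rfl⟩, hn⟩ := hz (min ε (|z| / 2)) (lt_min hε hδ)
    have hd : dist |z| |cosProduct θ (r * n)| ≤ dist z (cosProduct θ (r * n)) :=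
      abs_abs_sub_abs_le_abs_sub _ _
    refine ⟨_, ⟨distSeq θ (r * n), hM _ ?_ ⟨2 * D * n, ?_⟩, rfl⟩, ?_⟩
    · rw [Real.dist_eq] at hd
      have := (abs_lt.1 (hd.trans_lt (hn.trans_le (min_le_right _ _)))).2
      linarith
    · rw [← hh]
      push_cast
      field_simp
    · rw [blockValue_distSeq hθ.1]
      exact hd.trans_lt (hn.trans_le (min_le_left _ _))
  exact (hScount.union (hScount.image _)).mono hsub

/-! ### Passing between real and complex values -/

theorem derivedSet_ofReal_image (F : Set ℝ) :
    derivedSet (Complex.ofReal '' F) = Complex.ofReal '' derivedSet F := by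
  refine Subset.antisymm (fun z hz => ?_)
    (Complex.continuous_ofReal.image_derivedSet Complex.ofReal_injective)
  have hrange : z ∈ Set.range Complex.ofReal := by
    have h1 : closure (Complex.ofReal '' F) ⊆ Set.range Complex.ofReal :=
      closure_minimal (image_subset_range _ _)
        Complex.isometry_ofReal.isClosedEmbedding.isClosed_range
    exact h1 (derivedSet_subset_closure _ hz)
  obtain ⟨x, rfl⟩ := hrange
  refine ⟨x, ?_, rfl⟩
  rw [mem_derivedSet, accPt_iff_frequently] at hz ⊢
  have hre : Tendsto Complex.re (𝓝 (x : ℂ)) (𝓝 x) := by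
    simpa using Complex.continuous_re.tendsto (x : ℂ)
  refine hre.frequently (hz.mono ?_)
  rintro _ ⟨hne, a, ha, rfl⟩
  exact ⟨fun h => hne (congrArg Complex.ofReal (by simpa using h)), by simpa using ha⟩

theorem fourierValues_bernoulliConvolution {θ : ℝ} (hθ : 1 < θ) (r : ℝ) :
    fourierValues (bernoulliConvolution θ) r =
      Complex.ofReal '' Set.range fun n : ℤ => cosProduct θ (r * n) := by
  rw [fourierValues, ← Set.range_comp]
  refine congrArg Set.range (funext fun n => ?_)
  exact fourierTransform_bernoulliConvolution hθ _

theorem fourierLimitPoints_bernoulliConvolution {θ : ℝ} (hθ : 1 < θ) :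
    fourierLimitPoints (bernoulliConvolution θ) =
      Complex.ofReal '' {x | MapClusterPt x atTop (cosProduct θ)} := by
  have hF : fourierTransform (bernoulliConvolution θ) = Complex.ofReal ∘ cosProduct θ :=
    funext fun t => fourierTransform_bernoulliConvolution hθ t
  have hemb := Complex.isometry_ofReal.isClosedEmbedding
  have hiff : ∀ x : ℝ, MapClusterPt (x : ℂ) atTop (Complex.ofReal ∘ cosProduct θ) ↔
      MapClusterPt x atTop (cosProduct θ) := by
    intro x
    rw [MapClusterPt, MapClusterPt, ← map_map]
    exact hemb.isInducing.mapClusterPt_iff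
  ext z
  rw [fourierLimitPoints, hF]
  constructor
  · intro hz
    have hz' : z ∈ Set.range Complex.ofReal := by
      refine hemb.isClosed_range.closure_subset ?_
      rw [mem_closure_iff_clusterPt]
      refine ClusterPt.mono hz ?_
      rw [le_principal_iff, mem_map]
      exact Filter.univ_mem' fun t => ⟨_, rfl⟩
    obtain ⟨x, rfl⟩ := hz'
    exact ⟨x, (hiff x).1 hz, rfl⟩
  · rintro ⟨x, hx, rfl⟩
    exact (hiff x).2 hx

/-! ### The limit points at infinity -/

theorem mapClusterPt_atTop_iff {f : ℝ → ℝ} {x : ℝ} :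
    MapClusterPt x atTop f ↔ ∀ ε > 0, ∀ T, ∃ t ≥ T, |f t - x| < ε := by
  rw [Metric.nhds_basis_ball.mapClusterPt_iff_frequently]
  refine forall₂_congr fun ε _ => ?_
  rw [frequently_atTop]
  simp [Real.dist_eq]

/-- Near infinity `f` returns close to any two limit points, so on every half-line it takes each
value strictly between them. -/
theorem exists_setOf_mapClusterPt_eq_Icc {f : ℝ → ℝ} (hf : Continuous f)
    (hb : ∀ t, |f t| ≤ 1) {x y : ℝ} (hx : MapClusterPt x atTop f) (hy : MapClusterPt y atTop f)
    (hxy : x ≠ y) : ∃ a b, a < b ∧ {z | MapClusterPt z atTop f} = Icc a b := by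
  set J := {z | MapClusterPt z atTop f} with hJ
  have hclosed : IsClosed J := isClosed_setOfPred_clusterPt
  have hsub : J ⊆ Icc (-1) 1 := by
    intro z hz
    have hz' : z ∈ closure (Icc (-1 : ℝ) 1) := by
      rw [mem_closure_iff_clusterPt]
      refine ClusterPt.mono hz ?_
      rw [le_principal_iff, mem_map]
      exact Filter.univ_mem' fun t => abs_le.1 (hb t)
    rwa [isClosed_Icc.closure_eq] at hz'
  have hcomp : IsCompact J := isCompact_Icc.of_isClosed_subset hclosed hsub
  have hne : J.Nonempty := ⟨x, hx⟩
  have hord : ∀ p ∈ J, ∀ q ∈ J, ∀ c, p < c → c < q → c ∈ J := by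
    intro p hp q hq c hpc hcq
    refine mapClusterPt_atTop_iff.2 fun ε hε T => ?_
    obtain ⟨t, ht, htp⟩ := mapClusterPt_atTop_iff.1 hp (c - p) (by linarith) T
    obtain ⟨t', ht', htq⟩ := mapClusterPt_atTop_iff.1 hq (q - c) (by linarith) T
    have h1 : f t ≤ c := by linarith [(abs_lt.1 htp).2]
    have h2 : c ≤ f t' := by linarith [(abs_lt.1 htq).1]
    obtain ⟨s, hs, hsc⟩ := isPreconnected_Ici.intermediate_value (mem_Ici.2 ht) (mem_Ici.2 ht')
      hf.continuousOn ⟨h1, h2⟩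
    exact ⟨s, hs, by rw [hsc, sub_self, abs_zero]; exact hε⟩
  have hmin := hcomp.sInf_mem hne
  have hmax := hcomp.sSup_mem hne
  have hle : ∀ z ∈ J, sInf J ≤ z ∧ z ≤ sSup J := fun z hz =>
    ⟨csInf_le hcomp.bddBelow hz, le_csSup hcomp.bddAbove hz⟩
  refine ⟨sInf J, sSup J, ?_, Subset.antisymm (fun z hz => hle z hz) ?_⟩
  · rcases hxy.lt_or_gt with h | h
    · linarith [(hle x hx).1, (hle y hy).2]
    · linarith [(hle y hy).1, (hle x hx).2]
  · rintro z ⟨hz1, hz2⟩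
    rcases hz1.eq_or_lt with rfl | hz1
    · exact hmin
    rcases hz2.eq_or_lt with rfl | hz2
    · exact hmax
    exact hord _ hmin _ hmax z hz1 hz2

theorem mapClusterPt_cosProduct_zero {θ : ℝ} (hθ : 1 < θ) :
    MapClusterPt 0 atTop (cosProduct θ) := by
  refine mapClusterPt_atTop_iff.2 fun ε hε T => ?_
  obtain ⟨n, hn⟩ := exists_nat_ge T
  -- At these points the factor `k = 0` is `cos (π / 2 + 2π n) = 0`.
  refine ⟨1 / 4 + n, by linarith, ?_⟩
  have h0 := abs_tprod_le_abs (multipliable_cosProduct hθ (1 / 4 + n))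
    (fun _ => Real.abs_cos_le_one _) 0
  have hcos : Real.cos (2 * Real.pi * (1 / 4 + n) * (θ ^ 0)⁻¹) = 0 := by
    have : 2 * Real.pi * (1 / 4 + n) * (θ ^ 0)⁻¹ = Real.pi / 2 + n * (2 * Real.pi) := by
      rw [pow_zero]; ring
    rw [this, Real.cos_add_nat_mul_two_pi, Real.cos_pi_div_two]
  rw [hcos, abs_zero] at h0
  rw [sub_zero]
  exact h0.trans_lt hε

theorem IsPisot.exists_mapClusterPt_ne_zero {θ : ℝ} (hθ : IsPisot θ) (hθ2 : θ ≠ 2) :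
    ∃ w, w ≠ 0 ∧ MapClusterPt w atTop (cosProduct θ) := by
  obtain ⟨c, hc0, -, hc⟩ := hθ.exists_biCosProduct_ne_zero hθ2 one_pos
  refine ⟨biCosProduct θ c, hc, ?_⟩
  have hmem : (c : ℝ) ∈ pisotModule θ := by
    simpa using nsmul_mem hθ.one_mem_pisotModule c
  have hT : Tendsto (fun N : ℕ => (c : ℝ) * θ ^ N) atTop atTop :=
    (tendsto_pow_atTop_atTop_of_one_lt hθ.1).const_mul_atTop (by positivity)
  exact MapClusterPt.of_comp hT (tendsto_cosProduct_mul_pow hθ.1 hmem).mapClusterPt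

/-- The finitely many values with `|n| ≤ N` cannot accumulate, so approximating values come from
large `|n|`; evenness moves them to `+∞`. -/
theorem derivedSet_range_subset {f : ℝ → ℝ} (heven : ∀ t, f (-t) = f t) {r : ℝ} (hr : 0 < r) :
    derivedSet (Set.range fun n : ℤ => f (r * n)) ⊆ {z | MapClusterPt z atTop f} := by
  intro x hx
  refine mapClusterPt_atTop_iff.2 fun ε hε T => ?_
  obtain ⟨N, hN⟩ := exists_nat_ge (T / r)
  rw [mem_derivedSet, accPt_iff_frequently] at hx
  set A : Set ℝ := (fun n : ℤ => f (r * n)) '' Icc (-(N : ℤ)) N \ {x} with hA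
  have hAfin : A.Finite := ((Set.finite_Icc _ _).image _).sdiff
  have hAx : ∀ᶠ y in 𝓝 x, y ∉ A := hAfin.isClosed.compl_mem_nhds fun h => h.2 rfl
  obtain ⟨_, ⟨hne, n, rfl⟩, hyA, hyx⟩ := (hx.and_eventually
    (hAx.and (Metric.ball_mem_nhds x hε))).exists
  have hn : (N : ℤ) < |n| := by
    by_contra! hle
    exact hyA ⟨⟨n, abs_le.1 hle, rfl⟩, hne⟩
  have hfn : f (r * |(n : ℝ)|) = f (r * n) := by
    rcases abs_choice (n : ℝ) with h | h
    · rw [h]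
    · rw [h, mul_neg, heven]
  refine ⟨r * |(n : ℝ)|, ?_, ?_⟩
  · have h1 : (N : ℝ) < |(n : ℝ)| := by exact_mod_cast hn
    have h2 : T / r ≤ |(n : ℝ)| := hN.trans h1.le
    rw [div_le_iff₀ hr] at h2
    linarith
  · rw [hfn]
    simpa [Real.dist_eq] using hyx

/-! ### Almost every dilation -/

theorem measure_inter_closedBall_div_le {S : Set ℝ} {x ρ c δ : ℝ} (hρ : 0 < ρ)
    (hsub : Metric.ball c δ ⊆ Metric.closedBall x ρ) (hdisj : Disjoint (Metric.ball c δ) S) :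
    volume (S ∩ Metric.closedBall x ρ) / volume (Metric.closedBall x ρ) ≤
      ENNReal.ofReal (1 - δ / ρ) := by
  have h1 : volume (S ∩ Metric.closedBall x ρ) ≤
      volume (Metric.closedBall x ρ \ Metric.ball c δ) :=
    measure_mono fun y hy => ⟨hy.2, fun hy' => hdisj.notMem_of_mem_left hy' hy.1⟩
  rw [measure_sdiff hsub measurableSet_ball.nullMeasurableSet measure_ball_lt_top.ne, Real.volume_closedBall,
    Real.volume_ball] at h1
  rw [Real.volume_closedBall]
  refine ENNReal.div_le_of_le_mul (h1.trans ?_)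
  rcases le_or_gt δ 0 with hδ | hδ
  · rw [ENNReal.ofReal_of_nonpos (p := 2 * δ) (by linarith), tsub_zero,
      ← ENNReal.ofReal_mul' (by linarith)]
    refine ENNReal.ofReal_le_ofReal ?_
    have : δ / ρ ≤ 0 := div_nonpos_of_nonpos_of_nonneg hδ hρ.le
    nlinarith
  · rw [← ENNReal.ofReal_sub _ (by linarith), ← ENNReal.ofReal_mul' (by linarith)]
    refine ENNReal.ofReal_le_ofReal (le_of_eq ?_)
    field_simp

/-- Near a large `t` with `f t` close to `z`, the function stays close on an interval of fixed
radius `δ`. Dividing by `n ≈ t / x` gives a hole of radius `δ / n` in the bad set, within distance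
`2x / n` of `x`: a fixed proportion at arbitrarily small scales. So `x` is not a density point. -/
theorem volume_setOf_far_eq_zero {f : ℝ → ℝ} {C : ℝ} (hC : 0 < C)
    (hf : ∀ s t, |f s - f t| ≤ C * |s - t|) {z : ℝ} (hz : MapClusterPt z atTop f) {ε : ℝ}
    (hε : 0 < ε) : volume {r : ℝ | 0 < r ∧ ∀ n : ℤ, ε ≤ |f (r * n) - z|} = 0 := by
  set S := {r : ℝ | 0 < r ∧ ∀ n : ℤ, ε ≤ |f (r * n) - z|} with hS
  have hcont : Continuous f := (LipschitzWith.of_dist_le_mul (K := ⟨C, hC.le⟩)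
    fun s t => hf s t).continuous
  have hmeas : MeasurableSet S := by
    have : S = Ioi 0 ∩ ⋂ n : ℤ, {r : ℝ | ε ≤ |f (r * n) - z|} := by
      ext r
      simp [hS]
    rw [this]
    refine measurableSet_Ioi.inter (MeasurableSet.iInter fun n => IsClosed.measurableSet ?_)
    exact isClosed_le continuous_const (by fun_prop)
  by_contra hne
  have hae := Besicovitch.ae_tendsto_measure_inter_div volume S
  have : (ae (volume.restrict S)).NeBot := by
    rw [ae_neBot, Ne, Measure.restrict_eq_zero]
    exact hne
  obtain ⟨x, hx, hxS⟩ := (hae.and (ae_restrict_mem hmeas)).exists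
  have hx0 : 0 < x := hxS.1
  -- The bound `ε / (2C)` keeps the variation of `f` below `ε / 2`; the bound `x` keeps the hole
  -- inside the ball of radius `2x / n`.
  set δ := min x (ε / (2 * C)) with hδ
  have hδ0 : 0 < δ := lt_min hx0 (by positivity)
  have hlt : ENNReal.ofReal (1 - δ / (2 * x)) < 1 := by
    rw [ENNReal.ofReal_lt_one]
    have : 0 < δ / (2 * x) := by positivity
    linarith
  have hev := hx.eventually_const_lt hlt
  rw [eventually_nhdsWithin_iff, Metric.eventually_nhds_iff] at hev
  obtain ⟨ρ₀, hρ₀, hev⟩ := hev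
  -- The lower bound `4x² / ρ₀` ensures `2x / n < ρ₀` for `n = ⌈t / x⌉`.
  obtain ⟨t, ht, htz⟩ := mapClusterPt_atTop_iff.1 hz (ε / 2) (by positivity)
    (max x (4 * x ^ 2 / ρ₀))
  have htx : x ≤ t := (le_max_left _ _).trans ht
  have ht0 : 0 < t := hx0.trans_le htx
  have htρ : 4 * x ^ 2 / ρ₀ ≤ t := (le_max_right _ _).trans ht
  set n : ℕ := ⌈t / x⌉₊ with hn
  have hn1 : t / x ≤ n := Nat.le_ceil _
  have hn2 : (n : ℝ) < t / x + 1 := Nat.ceil_lt_add_one (by positivity)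
  have hnpos : (0 : ℝ) < n := lt_of_lt_of_le (by positivity) hn1
  rw [div_le_iff₀ hx0] at hn1
  have hn2' : n * x < t + x := by
    have := mul_lt_mul_of_pos_right hn2 hx0
    rwa [add_mul, div_mul_cancel₀ _ hx0.ne', one_mul] at this
  have hρ : 0 < 2 * x / n := by positivity
  have hsmall : 2 * x / n < ρ₀ := by
    rw [div_lt_iff₀ hnpos]
    rw [div_le_iff₀ hρ₀] at htρ
    have h3 : 4 * x ^ 2 ≤ n * x * ρ₀ := htρ.trans (by gcongr)
    have h4 : 4 * x ≤ ρ₀ * n := by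
      refine le_of_mul_le_mul_right ?_ hx0
      nlinarith
    linarith
  have hgt := hev (y := 2 * x / n) (by
    rw [Real.dist_eq, sub_zero, abs_of_pos hρ]
    exact hsmall) hρ
  refine absurd hgt (not_lt.2 ?_)
  have hle := measure_inter_closedBall_div_le (S := S) (x := x) (c := t / n) (δ := δ / n) hρ ?_ ?_
  · refine hle.trans_eq ?_
    congr 2
    field_simp
  · intro y hy
    rw [Metric.mem_ball, Real.dist_eq] at hy
    rw [Metric.mem_closedBall, Real.dist_eq]
    have h5 : |t / n - x| ≤ x / n := by
      rw [abs_le, neg_le_sub_iff_le_add, sub_le_iff_le_add]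
      constructor
      · rw [← sub_le_iff_le_add, le_div_iff₀ hnpos, sub_mul, div_mul_cancel₀ _ hnpos.ne']
        nlinarith
      · rw [div_le_iff₀ hnpos, add_mul, div_mul_cancel₀ _ hnpos.ne']
        nlinarith
    have h6 : δ / n ≤ x / n := by
      gcongr
      exact min_le_left _ _
    calc |y - x| ≤ |y - t / n| + |t / n - x| := abs_sub_le _ _ _
      _ ≤ x / n + x / n := by linarith
      _ = 2 * x / n := by ring
  · rw [Set.disjoint_left]
    intro y hy hyS
    rw [Metric.mem_ball, Real.dist_eq] at hy
    have h7 : |y * n - t| < δ := by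
      have : y * n - t = (y - t / n) * n := by
        rw [sub_mul, div_mul_cancel₀ _ hnpos.ne']
      rw [this, abs_mul, abs_of_pos hnpos]
      rwa [lt_div_iff₀ hnpos] at hy
    have h8 := hyS.2 n
    have h9 : |f (y * n) - f t| ≤ ε / 2 := by
      refine (hf _ _).trans ?_
      have : δ ≤ ε / (2 * C) := min_le_right _ _
      calc C * |y * n - t| ≤ C * (ε / (2 * C)) := by
            gcongr
            linarith
        _ = ε / 2 := by field_simp
    have h10 : |f (y * n) - z| ≤ |f (y * n) - f t| + |f t - z| := abs_sub_le _ _ _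
    rw [Int.cast_natCast] at h8
    linarith

/-- Rational targets and tolerances `1 / (m + 1)` leave countably many null sets to exclude; density
gives the remaining targets. -/
theorem ae_Icc_subset_closure_range {f : ℝ → ℝ} {C : ℝ} (hC : 0 < C)
    (hf : ∀ s t, |f s - f t| ≤ C * |s - t|) {a b : ℝ} (hab : a < b)
    (hJ : Icc a b ⊆ {z | MapClusterPt z atTop f}) :
    ∀ᵐ r : ℝ ∂(volume.restrict (Ioi 0)),
      Icc a b ⊆ closure (Set.range fun n : ℤ => f (r * n)) := by
  have h1 : ∀ (q : ℚ) (m : ℕ), ∀ᵐ r : ℝ ∂(volume.restrict (Ioi 0)), (q : ℝ) ∈ Ioo a b →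
      ∃ n : ℤ, |f (r * n) - q| < 1 / ((m : ℝ) + 1) := by
    intro q m
    rw [ae_restrict_iff' measurableSet_Ioi, ae_iff]
    by_cases hq : (q : ℝ) ∈ Ioo a b
    · refine measure_mono_null (fun r hr => ?_) (volume_setOf_far_eq_zero hC hf
        (hJ (Ioo_subset_Icc_self hq)) (Nat.one_div_pos_of_nat (n := m) (α := ℝ)))
      simpa [hq] using hr
    · simp [hq]
  have h2 := ae_all_iff.2 fun q => ae_all_iff.2 (h1 q)
  filter_upwards [h2] with r hr
  rw [← closure_Ioo hab.ne]
  refine closure_minimal ?_ isClosed_closure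
  have hdense : Ioo a b ⊆ closure (Ioo a b ∩ Set.range ((↑) : ℚ → ℝ)) :=
    Rat.denseRange_cast.open_subset_closure_inter isOpen_Ioo
  refine hdense.trans (closure_minimal ?_ isClosed_closure)
  rintro _ ⟨hq, q, rfl⟩
  rw [Metric.mem_closure_iff]
  intro ε hε
  obtain ⟨m, hm⟩ := exists_nat_one_div_lt hε
  obtain ⟨n, hn⟩ := hr q m hq
  refine ⟨_, ⟨n, rfl⟩, ?_⟩
  rw [dist_comm, Real.dist_eq]
  exact hn.trans hm

/-! ### The main theorem -/

theorem theorem2 (θ : ℝ) (hθ : IsPisot θ) (hθ2 : θ ≠ 2) :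
    (∀ r : ℝ, 0 < r → r ∈ IntermediateField.adjoin ℚ ({θ} : Set ℝ) →
      (derivedSet (fourierValues (bernoulliConvolution θ) r)).Countable ∧
      (derivedSet (fourierValues (bernoulliConvolution θ) r)).Infinite) ∧
    (∃ a b : ℝ, a < b ∧
      fourierLimitPoints (bernoulliConvolution θ) = Complex.ofReal '' Set.Icc a b ∧
      ∀ᵐ r : ℝ ∂(volume.restrict (Set.Ioi 0)),
        derivedSet (fourierValues (bernoulliConvolution θ) r) =
          fourierLimitPoints (bernoulliConvolution θ)) := by
  refine ⟨fun r hr hrmem => ?_, ?_⟩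
  · rw [fourierValues_bernoulliConvolution hθ.1, derivedSet_ofReal_image]
    refine ⟨((hθ.countable_closure_range hr.ne' hrmem).mono
      (derivedSet_subset_closure _)).image _, ?_⟩
    exact (hθ.infinite_derivedSet hθ2 hr.ne' hrmem).image Complex.ofReal_injective.injOn
  · obtain ⟨w, hw0, hw⟩ := hθ.exists_mapClusterPt_ne_zero hθ2
    obtain ⟨a, b, hab, hJ⟩ := exists_setOf_mapClusterPt_eq_Icc (continuous_cosProduct hθ.1)
      (abs_cosProduct_le_one hθ.1) hw (mapClusterPt_cosProduct_zero hθ.1) hw0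
    obtain ⟨C, hC, hlip⟩ := exists_cosProduct_lipschitz hθ.1
    rw [fourierLimitPoints_bernoulliConvolution hθ.1, hJ]
    refine ⟨a, b, hab, rfl, ?_⟩
    filter_upwards [ae_Icc_subset_closure_range hC hlip hab hJ.ge,
      ae_restrict_mem measurableSet_Ioi] with r hr hr0
    rw [fourierValues_bernoulliConvolution hθ.1, derivedSet_ofReal_image]
    congr 1
    refine Subset.antisymm ?_ ?_
    · rw [← hJ]
      exact derivedSet_range_subset (cosProduct_neg θ) hr0
    -- The closure of the values contains the interval, all of whose points are accumulation points
    -- of the interval itself.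
    · have hperf : Preperfect (Icc a b) :=
        isPreconnected_Icc.preperfect_of_nontrivial
          ⟨a, left_mem_Icc.2 hab.le, b, right_mem_Icc.2 hab.le, hab.ne⟩
      rw [← derivedSet_closure]
      exact (preperfect_iff_subset_derivedSet.1 hperf).trans (derivedSet_mono _ _ hr)
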